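/- For $\alpha\in(0,1)$ and $\lambda>0$ let $X_{\alpha,\lambda}$ denote a Mittag-Leffler random variable of index $\alpha$ and scale $\lambda$, i.e. $X_{\alpha,\lambda}\ge 0$ with $$P\{X_{\alpha,\lambda}\le t\}=1-E_{\alpha,1}(-(\lambda t)^{\alpha})\quad(t\ge 0),\qquad E_{\alpha,1}(z)=\sum_{\ell\ge 0}\frac{z^{\ell}}{\Gamma(1+\alpha\ell)} .$$ Let $\alpha,\beta\in(0,1)$ and $\lambda,\mu>0$, and let $(X^{(n)})_{n\ge1}$, $(Y^{(n)})_{n\ge1}$ be two independent i.i.d. sequences with $X^{(n)}\sim X_{\alpha,\lambda}$ and $Y^{(n)}\sim X_{\beta,\mu}$. The renewal queue has inter-event times $X^{(n)}\wedge Y^{(n)}$. Its $n$-th event is an arrival if $X^{(n)}<Y^{(n)}$, and otherwise a departure attempt, which removes one customer if the queue is non-empty and has no effect if it is empty. Let $Q_n$ be the queue length after $n$ events (the embedded queue, a Markov chain on $\{0,1,2,\dots\}$, started from any state $Q_0=i_0$), let $R_t=\max\{n:\sum_{k\le n}X^{(k)}\wedge Y^{(k)}\le t\}$ be the number of events up to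 time $t$, and let $L_t=Q_{R_t}$ be the queue length at time $t$. Then for all $\alpha,\beta\in(0,1)$ there is a critical value $\rho^*_{\alpha,\beta}\in(0,\infty)$, depending only on $\alpha$ and $\beta$, such that for all $\lambda,\mu>0$: 1. the embedded queue $(Q_n)$ is transient if and only if $\lambda/\mu>\rho^*_{\alpha,\beta}$; 2. if $\lambda/\mu<\rho^*_{\alpha,\beta}$, then with $p=P\{X_{\alpha,\lambda}<X_{\beta,\mu}\}$ (the two variables being independent) the weights $$\pi_j=\frac{1-2p}{1-p}\Big(\frac{p}{1-p}\Big)^{j},\qquad j=0,1,2,\dots,$$ form a probability distribution, which is the unique invariant distribution of $(Q_n)$, and for every initial state and every $j$ one has $\lim_{n\to\infty}P\{Q_n=j\}=\pi_j$ and $\lim_{t\to\infty}P\{L_t=j\}=\pi_j$; 3. if $\lambda/\mu=\rho^*_{\alpha,\beta}$, then the embedded queue $(Q_n)$ is null recurrent. -/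

import Mathlib

open MeasureTheory ProbabilityTheory Filter Topology
open scoped ENNReal

noncomputable section

namespace RenewalQueue

/-- The two-parameter Mittag-Leffler function `E_{a,b}(z) = ∑ z ^ l / Γ(b + a l)`
(the series converges absolutely for every real `z` when `a, b > 0`). -/
def mittagLeffler (a b z : ℝ) : ℝ :=
  ∑' l : ℕ, z ^ l / Real.Gamma (b + a * l)

/-- The cumulative distribution function of the Mittag-Leffler law of index `a` and
scale `r`: it is `1 - E_{a,1}(-(r t)^a)` for `t ≥ 0`, and `0` for `t < 0`. -/
def mittagLefflerCDF (a r t : ℝ) : ℝ :=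
  if t < 0 then 0 else 1 - mittagLeffler a 1 (-(r * t) ^ a)

variable {Ω : Type*}

/-- `X` and `Y` are two independent i.i.d. sequences of Mittag-Leffler random variables, the
first of index `a` and scale `lam`, the second of index `b` and scale `mu`. -/
structure IsMittagLefflerClocks [MeasurableSpace Ω] (P : Measure Ω) (a b lam mu : ℝ)
    (X Y : ℕ → Ω → ℝ) : Prop where
  measurable_left : ∀ n, Measurable (X n)
  measurable_right : ∀ n, Measurable (Y n)
  cdf_left : ∀ n t, P.real {ω | X n ω ≤ t} = mittagLefflerCDF a lam t
  cdf_right : ∀ n t, P.real {ω | Y n ω ≤ t} = mittagLefflerCDF b mu t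
  indep : iIndepFun (Sum.elim X Y : ℕ ⊕ ℕ → Ω → ℝ) P

/-- The embedded queue length after `n` events, started from `i` customers. The event number
`n + 1` is an arrival if the clock `X n` rings strictly before `Y n`, and a departure attempt
otherwise. A departure attempt removes one customer if there is one and has no effect on an
empty queue (the subtraction of natural numbers is truncated). -/
def embeddedQueue (X Y : ℕ → Ω → ℝ) (i : ℕ) : ℕ → Ω → ℕ
  | 0, _ => i
  | n + 1, ω =>
    if X n ω < Y n ω then embeddedQueue X Y i n ω + 1 else embeddedQueue X Y i n ω - 1

/-- The time of the `n`-th event: the sum of the first `n` inter-event times `min X Y`. -/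
def eventTime (X Y : ℕ → Ω → ℝ) (n : ℕ) (ω : Ω) : ℝ :=
  ∑ k ∈ Finset.range n, min (X k ω) (Y k ω)

/-- The renewal counting process `R_t`: the number of events up to time `t`. -/
def eventCount (X Y : ℕ → Ω → ℝ) (t : ℝ) (ω : Ω) : ℕ :=
  sSup {n : ℕ | eventTime X Y n ω ≤ t}

/-- The queue length at time `t`, which is the embedded queue length after `R_t` events. -/
def queueLength (X Y : ℕ → Ω → ℝ) (i : ℕ) (t : ℝ) (ω : Ω) : ℕ :=
  embeddedQueue X Y i (eventCount X Y t ω) ω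

/-! In the next definitions `Q i n` is the position at time `n` of a Markov chain on `ℕ` that
is started from the state `i`. -/

/-- Every state `i` is transient: started from `i`, the chain almost surely visits `i` only
finitely often. -/
def IsTransient [MeasurableSpace Ω] (P : Measure Ω) (Q : ℕ → ℕ → Ω → ℕ) : Prop :=
  ∀ i, P {ω | ∃ᶠ n in atTop, Q i n ω = i} = 0

/-- Every state `i` is recurrent: started from `i`, the chain almost surely visits `i`
infinitely often. -/
def IsRecurrent [MeasurableSpace Ω] (P : Measure Ω) (Q : ℕ → ℕ → Ω → ℕ) : Prop :=
  ∀ i, ∀ᵐ ω ∂P, ∃ᶠ n in atTop, Q i n ω = i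

/-- The first return time to the initial state `i`, equal to `∞` if there is no return. -/
def returnTime (Q : ℕ → ℕ → Ω → ℕ) (i : ℕ) (ω : Ω) : ℝ≥0∞ :=
  ⨅ n : ℕ, ⨅ _ : 1 ≤ n ∧ Q i n ω = i, (n : ℝ≥0∞)

/-- Every state is recurrent with infinite expected return time. -/
def IsNullRecurrent [MeasurableSpace Ω] (P : Measure Ω) (Q : ℕ → ℕ → Ω → ℕ) : Prop :=
  IsRecurrent P Q ∧ ∀ i, ∫⁻ ω, returnTime Q i ω ∂P = ∞

/-- The probability distribution `ν` is invariant under the transition probabilities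
`P (Q i 1 = j)` from `i` to `j`. -/
def IsInvariant [MeasurableSpace Ω] (P : Measure Ω) (Q : ℕ → ℕ → Ω → ℕ) (ν : PMF ℕ) : Prop :=
  ∀ j, ∑' i, ν i * P {ω | Q i 1 ω = j} = ν j

/-- The geometric weights `(1 - 2p)/(1 - p) * (p/(1 - p)) ^ j`. -/
def equilibriumWeight (p : ℝ) (j : ℕ) : ℝ :=
  (1 - 2 * p) / (1 - p) * (p / (1 - p)) ^ j

end RenewalQueue

end

open RenewalQueue

/-! Only the probability `p` that an event is an arrival matters for the embedded queue, which is a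
random walk with steps `±1` truncated at `0`. The proof relates `p` to the scales and then treats `p
> 1/2`, `p < 1/2` and `p = 1/2` in turn.

After rescaling by `mu`, `p` equals `f (lam / mu)` with `f r = ∫ F_a(r y) dν(y)`, where `F_a` is the
Mittag-Leffler cdf of scale one and `ν` is the law with cdf `F_b`. Since `F_a` is continuous and
increases strictly from `0` to `1` on the half-line, `f` does too, and the critical ratio solves `f
ρ = 1/2` (`exists_criticalRatio`). That `F_a` is a cdf at all is proved by discretization:
`E_{a,1}(-t^a)` is a limit of coefficients of `(1-z)^(-1) / (1 + δ (1-z)^(-a))` with `δ = N^(-a)`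
(`tendsto_discreteTail`). These coefficients are nonnegative and nonincreasing by an elementary
recursion, and analyticity upgrades monotonicity to strictness.

If `p > 1/2`, the walk tends to `+∞` by the strong law and carries the queue with it. If `p < 1/2`,
reversing the order of the first `m` events preserves the joint law of the clocks and the times of
events `m` and `m + 1`. The reversed queue is eventually constant along almost every path
(`exists_eventually_revQueue_eq`), so both `Q_n` and `L_t` converge in law to that constant's law,
with no renewal theorem or finite mean needed. The limit satisfies the balance equations, whose only
normalized solution is geometric.

If `p = 1/2`, the walk is a martingale with bounded increments that cannot converge, so it is
unbounded on both sides and the queue is recurrent. The first excursion above the starting state has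
constant mean `1/2` but tends to `0` and is dominated by the return time, which therefore has
infinite mean. -/

namespace RenewalQueue

/-! ### Coefficients of `(1 - z) ^ (-s)`: convolution, bounds and asymptotics. -/

/-- The coefficient of `z ^ n` in `(1 - z) ^ (-s)`. -/
noncomputable def rising (s : ℝ) (n : ℕ) : ℝ := ∏ j ∈ Finset.range n, (s + j) / (j + 1)

@[simp] lemma rising_zero_right (s : ℝ) : rising s 0 = 1 := by simp [rising]

lemma rising_succ (s : ℝ) (n : ℕ) : ((n : ℝ) + 1) * rising s (n + 1) = (s + n) * rising s n := by
  have : (n : ℝ) + 1 ≠ 0 := by positivity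
  rw [rising, Finset.prod_range_succ, ← rising]
  field_simp

lemma rising_nonneg {s : ℝ} (hs : 0 ≤ s) (n : ℕ) : 0 ≤ rising s n :=
  Finset.prod_nonneg fun j _ => by positivity

lemma rising_one (n : ℕ) : rising 1 n = 1 :=
  Finset.prod_eq_one fun j _ => by
    have : (j : ℝ) + 1 ≠ 0 := by positivity
    rw [add_comm, div_self this]

lemma rising_zero_left (n : ℕ) : rising 0 (n + 1) = 0 :=
  Finset.prod_eq_zero (Finset.mem_range.2 n.succ_pos) (by simp)

lemma rising_neg_nonpos {a : ℝ} (ha : 0 ≤ a) (ha1 : a ≤ 1) (n : ℕ) : rising (-a) (n + 1) ≤ 0 := by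
  rw [rising, Finset.prod_range_succ']
  refine mul_nonpos_of_nonneg_of_nonpos (Finset.prod_nonneg fun j _ => ?_) ?_
  · have : (0 : ℝ) ≤ j := by positivity
    push_cast
    exact div_nonneg (by linarith) (by positivity)
  · simp [ha]

/-- The Chu–Vandermonde identity for the coefficients of `(1 - z) ^ (-s)`. -/
lemma sum_antidiagonal_rising (s t : ℝ) (n : ℕ) :
    ∑ ij ∈ Finset.HasAntidiagonal.antidiagonal n, rising s ij.1 * rising t ij.2 = rising (s + t) n := by
  induction n with
  | zero => simp
  | succ n ih =>
    have h1 : ∑ ij ∈ Finset.HasAntidiagonal.antidiagonal (n + 1), ((ij.1 : ℝ) * rising s ij.1) * rising t ij.2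
        = ∑ ij ∈ Finset.HasAntidiagonal.antidiagonal n, (s + ij.1) * (rising s ij.1 * rising t ij.2) := by
      rw [Finset.Nat.sum_antidiagonal_succ]
      simp only [Nat.cast_zero, zero_mul, zero_add, Nat.cast_add, Nat.cast_one, rising_succ,
        mul_assoc]
    have h2 : ∑ ij ∈ Finset.HasAntidiagonal.antidiagonal (n + 1), rising s ij.1 * ((ij.2 : ℝ) * rising t ij.2)
        = ∑ ij ∈ Finset.HasAntidiagonal.antidiagonal n, (t + ij.2) * (rising s ij.1 * rising t ij.2) := by
      rw [Finset.Nat.sum_antidiagonal_succ']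
      simp only [Nat.cast_zero, zero_mul, mul_zero, zero_add, Nat.cast_add, Nat.cast_one,
        rising_succ]
      exact Finset.sum_congr rfl fun ij _ => by ring
    have h3 : ((n : ℝ) + 1) * ∑ ij ∈ Finset.HasAntidiagonal.antidiagonal (n + 1), rising s ij.1 * rising t ij.2
        = (s + t + n) * rising (s + t) n := by
      rw [← ih, Finset.mul_sum, Finset.mul_sum]
      trans ∑ ij ∈ Finset.HasAntidiagonal.antidiagonal (n + 1), ((ij.1 : ℝ) * rising s ij.1) * rising t ij.2
        + ∑ ij ∈ Finset.HasAntidiagonal.antidiagonal (n + 1), rising s ij.1 * ((ij.2 : ℝ) * rising t ij.2)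
      · rw [← Finset.sum_add_distrib]
        refine Finset.sum_congr rfl fun ij hij => ?_
        have : ((ij.1 : ℝ) + ij.2) = n + 1 := by
          exact_mod_cast Finset.HasAntidiagonal.mem_antidiagonal.1 hij
        rw [← this]; ring
      · rw [h1, h2, ← Finset.sum_add_distrib]
        refine Finset.sum_congr rfl fun ij hij => ?_
        have : ((ij.1 : ℝ) + ij.2) = n := by
          exact_mod_cast Finset.HasAntidiagonal.mem_antidiagonal.1 hij
        rw [← this]; ring
    have : (n : ℝ) + 1 ≠ 0 := by positivity
    exact mul_left_cancel₀ this (h3.trans (rising_succ _ _).symm)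

lemma sum_range_rising (s : ℝ) (n : ℕ) :
    ∑ k ∈ Finset.range (n + 1), rising s k = rising (s + 1) n := by
  rw [← sum_antidiagonal_rising, Finset.Nat.sum_antidiagonal_eq_sum_range_succ_mk]
  simp [rising_one]

/-- The power series of `(1 - z) ^ (-s)`. -/
noncomputable def risingSeries (s : ℝ) : PowerSeries ℝ := PowerSeries.mk (rising s)

lemma risingSeries_mul (s t : ℝ) : risingSeries s * risingSeries t = risingSeries (s + t) := by
  ext n
  simp [PowerSeries.coeff_mul, risingSeries, sum_antidiagonal_rising]

lemma risingSeries_zero : risingSeries 0 = 1 := by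
  ext n
  cases n <;> simp [risingSeries, rising_zero_left, PowerSeries.coeff_one]

lemma factorial_mul_rising (s : ℝ) (n : ℕ) :
    (n.factorial : ℝ) * rising s n = ∏ j ∈ Finset.range n, (s + j) := by
  induction n with
  | zero => simp
  | succ n ih =>
    rw [Finset.prod_range_succ, ← ih, Nat.factorial_succ]
    push_cast
    linear_combination (n.factorial : ℝ) * rising_succ s n

lemma choose_eq_rising (s : ℝ) (n : ℕ) : Ring.choose (s + n - 1) n = rising s n := by
  have h : (n.factorial : ℝ) ≠ 0 := by positivity
  refine mul_left_cancel₀ h ?_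
  rw [factorial_mul_rising, Ring.choose, ← nsmul_eq_mul,
    Ring.factorial_nsmul_multichoose_eq_ascPochhammer]
  rw [Polynomial.ascPochhammer_smeval_eq_eval, show s + n - 1 - n + 1 = s by ring]
  induction n with
  | zero => simp
  | succ n ih => rw [ascPochhammer_succ_eval, Finset.prod_range_succ, ih (by positivity)]

lemma hasSum_rising (s : ℝ) {z : ℝ} (hz : 0 ≤ z) (hz1 : z < 1) :
    HasSum (fun n => rising s n * z ^ n) (1 / (1 - z) ^ s) := by
  have := (Real.one_div_one_sub_rpow_hasFPowerSeriesOnBall_zero s).hasSum (y := z) (by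
    simp [enorm_eq_nnnorm, ← NNReal.coe_lt_coe, abs_of_nonneg hz, hz1])
  simpa [FormalMultilinearSeries.ofScalars_apply_eq, choose_eq_rising, smul_eq_mul, mul_comm] using this

/-- By `sum_range_rising` the coefficient is a partial sum of nonnegative terms, and `z ^ n ≤ z ^ k`
for `k ≤ n`, so the full series at `z` dominates. -/
lemma rising_add_one_mul_pow_le {s : ℝ} (hs : 0 ≤ s) {z : ℝ} (hz : 0 ≤ z) (hz1 : z < 1) (n : ℕ) :
    rising (s + 1) n * z ^ n ≤ 1 / (1 - z) ^ s := by
  rw [← sum_range_rising, Finset.sum_mul]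
  refine le_trans (Finset.sum_le_sum fun k hk => ?_)
    ((hasSum_rising s hz hz1).summable.sum_le_tsum (Finset.range (n + 1)) fun k _ =>
      mul_nonneg (rising_nonneg hs k) (by positivity)) |>.trans_eq (hasSum_rising s hz hz1).tsum_eq
  exact mul_le_mul_of_nonneg_left
    (pow_le_pow_of_le_one hz hz1.le (Nat.lt_succ_iff.1 (Finset.mem_range.1 hk))) (rising_nonneg hs k)

/-- For `0 ≤ x ≤ 1/2` one has `1/(1 - x) ≤ 1 + 2x ≤ exp (2x)`; this is applied to `x = R/n`. -/
lemma inv_one_sub_pow_le {R : ℝ} (hR : 0 ≤ R) {n : ℕ} (hn : 2 * R < n) :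
    ((1 - R / n) ^ n)⁻¹ ≤ Real.exp (2 * R) := by
  have hn0 : (0 : ℝ) < n := by linarith
  have hx : R / n ≤ 1 / 2 := by rw [div_le_div_iff₀ hn0 two_pos]; linarith
  have hx0 : 0 ≤ R / n := by positivity
  rw [← inv_pow, show 2 * R = n * (2 * (R / n)) by field_simp, Real.exp_nat_mul]
  refine pow_le_pow_left₀ (inv_nonneg.2 (by linarith)) ?_ n
  rw [inv_le_iff_one_le_mul₀ (by linarith)]
  nlinarith [Real.add_one_le_exp (2 * (R / n))]

/-- A bound on `rising (s + 1) n` that is uniform in `s` and exponential in `s`. -/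
lemma rising_add_one_le {s : ℝ} (hs : 0 ≤ s) {R : ℝ} (hR : 0 < R) {n : ℕ} (hn : 2 * R < n) :
    rising (s + 1) n ≤ Real.exp (2 * R) * (n / R) ^ s := by
  have hn0 : (0 : ℝ) < n := by linarith
  have hx : R / n < 1 := by rw [div_lt_one hn0]; linarith
  have hx0 : 0 < R / n := by positivity
  have h := rising_add_one_mul_pow_le hs (z := 1 - R / n) (by linarith) (by linarith) n
  have hpos : 0 < (1 - R / n) ^ n := pow_pos (by linarith) n
  rw [← le_div_iff₀ hpos, div_eq_mul_inv] at h
  refine h.trans ?_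
  rw [mul_comm]
  refine mul_le_mul (inv_one_sub_pow_le hR.le hn) ?_
    (one_div_nonneg.2 (Real.rpow_nonneg (by linarith) s)) (by positivity)
  rw [sub_sub_cancel, one_div, ← Real.inv_rpow hx0.le, inv_div]

/-- This is Euler's limit for `Γ`: for `s > 0` the quotient is the reciprocal of `s * GammaSeq s n`.
-/
lemma tendsto_rising_div_rpow {s : ℝ} (hs : 0 ≤ s) :
    Tendsto (fun n : ℕ => rising (s + 1) n / (n : ℝ) ^ s) atTop (𝓝 (1 / Real.Gamma (1 + s))) := by
  rcases hs.eq_or_lt with rfl | hs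
  · simp [rising_one]
  have hG : 0 < Real.Gamma (s + 1) := Real.Gamma_pos_of_pos (by linarith)
  have h := ((Real.GammaSeq_tendsto_Gamma s).const_mul s).inv₀
    (by rw [← Real.Gamma_add_one hs.ne']; exact hG.ne')
  rw [← Real.Gamma_add_one hs.ne', add_comm s 1] at h
  rw [one_div]
  refine h.congr' ?_
  filter_upwards [eventually_gt_atTop 0] with n hn
  have hn0 : (0 : ℝ) < n := by exact_mod_cast hn
  have h2 := factorial_mul_rising (s + 1) n
  have h3 : ∏ j ∈ Finset.range (n + 1), (s + j) = s * ∏ j ∈ Finset.range n, (s + 1 + j) := by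
    rw [Finset.prod_range_succ', mul_comm]
    simp [add_assoc, add_comm (1 : ℝ)]
  have h4 : (n.factorial : ℝ) ≠ 0 := by positivity
  have h5 : (n : ℝ) ^ s ≠ 0 := by positivity
  rw [Real.GammaSeq, h3, ← h2]
  field_simp

/-! ### Discrete Mittag-Leffler tails. -/

/-- The factor `(1 - z)^a + δ` has constant term `1 + δ` and nonpositive higher coefficients, so the
recursion writes `(1 + δ) V_n` as `B_n` plus a nonnegative combination of earlier `V_k`. -/
lemma coeff_nonneg_of_mul_eq {a δ : ℝ} (ha : 0 ≤ a) (ha1 : a ≤ 1) (hδ : 0 < δ)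
    {V B : PowerSeries ℝ} (h : V * (risingSeries (-a) + PowerSeries.C δ) = B)
    (hB : ∀ n, 0 ≤ PowerSeries.coeff n B) (n : ℕ) : 0 ≤ PowerSeries.coeff n V := by
  induction n using Nat.strong_induction_on with
  | _ n ih =>
    have h1 := congrArg (PowerSeries.coeff n) h
    rw [PowerSeries.coeff_mul, Finset.Nat.sum_antidiagonal_eq_sum_range_succ_mk,
      Finset.sum_range_succ] at h1
    have h2 : ∑ k ∈ Finset.range n, PowerSeries.coeff k V *
        PowerSeries.coeff (n - k) (risingSeries (-a) + PowerSeries.C δ) ≤ 0 := by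
      refine Finset.sum_nonpos fun k hk => mul_nonpos_of_nonneg_of_nonpos
        (ih k (Finset.mem_range.1 hk)) ?_
      obtain ⟨m, hm⟩ : ∃ m, n - k = m + 1 :=
        ⟨n - k - 1, by have := Finset.mem_range.1 hk; omega⟩
      simpa [hm, risingSeries, PowerSeries.coeff_C] using rising_neg_nonpos ha ha1 m
    have h3 : PowerSeries.coeff (n - n) (risingSeries (-a) + PowerSeries.C δ) = 1 + δ := by
      simp [risingSeries]
    simp only [h3] at h1
    have h4 : 0 ≤ PowerSeries.coeff n V * (1 + δ) := by linarith [hB n]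
    exact nonneg_of_mul_nonneg_left h4 (by linarith)

/-- The generating function of the tails of a discrete Mittag-Leffler law. -/
noncomputable def discreteTail (a δ : ℝ) : PowerSeries ℝ :=
  risingSeries 1 * (1 + PowerSeries.C δ * risingSeries a)⁻¹

lemma constantCoeff_one_add_ne_zero {a δ : ℝ} (hδ : 0 < δ) :
    PowerSeries.constantCoeff (1 + PowerSeries.C δ * risingSeries a) ≠ 0 := by
  have : PowerSeries.constantCoeff (risingSeries a) = 1 := by
    rw [← PowerSeries.coeff_zero_eq_constantCoeff_apply]; simp [risingSeries]
  simp only [map_add, map_one, map_mul, PowerSeries.constantCoeff_C, this]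
  positivity

lemma discreteTail_mul_one_add {a δ : ℝ} (hδ : 0 < δ) :
    discreteTail a δ * (1 + PowerSeries.C δ * risingSeries a) = risingSeries 1 := by
  rw [discreteTail, mul_assoc, PowerSeries.inv_mul_cancel _ (constantCoeff_one_add_ne_zero hδ),
    mul_one]

lemma discreteTail_mul {a δ : ℝ} (hδ : 0 < δ) :
    discreteTail a δ * (risingSeries (-a) + PowerSeries.C δ) = risingSeries (1 - a) := by
  have h : risingSeries a * risingSeries (-a) = 1 := by
    rw [risingSeries_mul, add_neg_cancel, risingSeries_zero]
  rw [sub_eq_add_neg, ← risingSeries_mul, ← discreteTail_mul_one_add hδ (a := a)]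
  linear_combination (-discreteTail a δ * PowerSeries.C δ) * h

lemma coeff_discreteTail_nonneg {a δ : ℝ} (hδ : 0 < δ) (ha : 0 ≤ a) (ha1 : a ≤ 1) (n : ℕ) :
    0 ≤ PowerSeries.coeff n (discreteTail a δ) :=
  coeff_nonneg_of_mul_eq ha ha1 hδ (discreteTail_mul hδ)
    (fun n => by simpa [risingSeries] using rising_nonneg (by linarith) n) n

/-- Multiplication by `1 - z` takes differences, and `1 - (1 - z) V = δ / ((1 - z)^a + δ)` has
nonnegative coefficients by the same recursion. Those of positive index are the decrements of `V`.
-/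
lemma coeff_discreteTail_antitone {a δ : ℝ} (hδ : 0 < δ) (ha : 0 ≤ a) (ha1 : a ≤ 1) :
    Antitone fun n => PowerSeries.coeff n (discreteTail a δ) := by
  have h1 : risingSeries 1 * risingSeries (-1) = 1 := by
    rw [risingSeries_mul, add_neg_cancel, risingSeries_zero]
  have h2 : (1 - discreteTail a δ * risingSeries (-1)) *
      (risingSeries (-a) + PowerSeries.C δ) = PowerSeries.C δ := by
    have h := discreteTail_mul hδ (a := a)
    rw [sub_eq_add_neg, ← risingSeries_mul] at h
    linear_combination -risingSeries (-1) * h - risingSeries (-a) * h1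
  have h3 := coeff_nonneg_of_mul_eq ha ha1 hδ h2 (fun n => by
    rw [PowerSeries.coeff_C]; split_ifs <;> simp [hδ.le])
  have h4 : discreteTail a δ = (discreteTail a δ * risingSeries (-1)) * risingSeries 1 := by
    linear_combination -discreteTail a δ * h1
  have h5 : ∀ n, PowerSeries.coeff n (discreteTail a δ) =
      ∑ k ∈ Finset.range (n + 1), PowerSeries.coeff k (discreteTail a δ * risingSeries (-1)) := by
    intro n
    conv_lhs => rw [h4]
    rw [PowerSeries.coeff_mul, Finset.Nat.sum_antidiagonal_eq_sum_range_succ_mk]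
    simp [risingSeries, rising_one]
  refine antitone_nat_of_succ_le fun n => ?_
  rw [h5, h5, Finset.sum_range_succ _ (n + 1)]
  have := h3 (n + 1)
  simp only [map_sub, PowerSeries.coeff_one, Nat.succ_ne_zero, if_false] at this
  linarith

lemma coeff_discreteTail_eq {a δ : ℝ} (hδ : 0 < δ) (n : ℕ) : PowerSeries.coeff n (discreteTail a δ) +
    δ * ∑ k ∈ Finset.range (n + 1), PowerSeries.coeff k (discreteTail a δ) * rising a (n - k)
      = 1 := by
  have h := congrArg (PowerSeries.coeff n) (discreteTail_mul_one_add hδ (a := a))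
  rw [mul_add, mul_one, mul_left_comm, map_add, PowerSeries.coeff_C_mul, PowerSeries.coeff_mul,
    Finset.Nat.sum_antidiagonal_eq_sum_range_succ_mk] at h
  simpa [risingSeries, rising_one] using h

/-- In the convolution identity `coeff_discreteTail_eq` every `V_k` with `k ≤ n` is at least `V_n`,
and the weights sum to `rising (a + 1) n`. In the limit this yields the decay of the Mittag-Leffler
tail. -/
lemma coeff_discreteTail_mul_le {a δ : ℝ} (hδ : 0 < δ) (ha : 0 ≤ a) (ha1 : a ≤ 1) (n : ℕ) :
    PowerSeries.coeff n (discreteTail a δ) * (1 + δ * rising (a + 1) n) ≤ 1 := by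
  refine le_of_le_of_eq ?_ (coeff_discreteTail_eq hδ (a := a) n)
  rw [← sum_range_rising, mul_add, mul_one, ← Finset.sum_range_reflect (fun k => rising a k)]
  rw [mul_left_comm, Finset.mul_sum]
  gcongr with k hk
  · exact rising_nonneg ha _
  · exact coeff_discreteTail_nonneg hδ ha ha1 k
  · have hkn := Nat.lt_succ_iff.1 (Finset.mem_range.1 hk)
    exact coeff_discreteTail_antitone hδ ha ha1 hkn
  · simp

/-- This is the geometric expansion in powers of `-δ (1 - z)^(-a)`. Multiplying the sum by `δ (1 -
z)^(-a)` shifts `l` by one and changes the sign, so only the term `l = 0` survives. -/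
lemma coeff_discreteTail_eq_tsum {a δ : ℝ} (hδ : 0 < δ) (n : ℕ)
    (hs : ∀ k, Summable fun l : ℕ => (-δ) ^ l * rising (a * l + 1) k) :
    PowerSeries.coeff n (discreteTail a δ) = ∑' l : ℕ, (-δ) ^ l * rising (a * l + 1) n := by
  set V : PowerSeries ℝ := PowerSeries.mk fun n => ∑' l : ℕ, (-δ) ^ l * rising (a * l + 1) n
    with hV
  suffices h : V * (1 + PowerSeries.C δ * risingSeries a) = risingSeries 1 by
    have h0 : (1 + PowerSeries.C δ * risingSeries a) ≠ 0 := fun h0 =>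
      constantCoeff_one_add_ne_zero hδ (a := a) (by rw [h0, map_zero])
    rw [mul_right_cancel₀ h0 ((discreteTail_mul_one_add hδ).trans h.symm), hV,
      PowerSeries.coeff_mk]
  ext n
  rw [mul_add, mul_one, mul_left_comm, map_add, PowerSeries.coeff_C_mul, PowerSeries.coeff_mul]
  simp only [hV, PowerSeries.coeff_mk, risingSeries, rising_one]
  have h1 : ∑ p ∈ Finset.HasAntidiagonal.antidiagonal n,
      (∑' l : ℕ, (-δ) ^ l * rising (a * l + 1) p.1) * rising a p.2
      = ∑' l : ℕ, (-δ) ^ l * rising (a * (l + 1 : ℕ) + 1) n := by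
    simp_rw [← tsum_mul_right]
    rw [← Summable.tsum_finsetSum fun p _ => (hs p.1).mul_right _]
    refine tsum_congr fun l => ?_
    rw [show a * ((l + 1 : ℕ) : ℝ) + 1 = (a * l + 1) + a by push_cast; ring,
      ← sum_antidiagonal_rising, Finset.mul_sum]
    exact Finset.sum_congr rfl fun p _ => by ring
  have hs' : Summable fun l : ℕ => (-δ) ^ (l + 1) * rising (a * (l + 1 : ℕ) + 1) n :=
    (summable_nat_add_iff (f := fun l : ℕ => (-δ) ^ l * rising (a * l + 1) n) 1).2 (hs n)
  rw [h1, (hs n).tsum_eq_zero_add, ← tsum_mul_left, add_assoc, ← Summable.tsum_add]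
  · simp only [pow_zero, one_mul, Nat.cast_zero, mul_zero, zero_add, rising_one, add_eq_left]
    rw [← tsum_zero (α := ℝ) (β := ℕ)]
    exact tsum_congr fun l => by ring
  · exact hs'
  · exact hs'.neg.congr fun l => by ring

/-! ### From discrete tails to the Mittag-Leffler function. -/

lemma rpow_neg_pow (a : ℝ) (N l : ℕ) : ((N : ℝ) ^ (-a)) ^ l = ((N : ℝ) ^ (a * l))⁻¹ := by
  rw [← Real.rpow_natCast, ← Real.rpow_mul (by positivity), ← Real.rpow_neg (by positivity),
    neg_mul]

/-- The coefficient bound at `z = 1/2` gives `rising (a * l + 1) k ≤ 2^k * 2^(a * l)`, hence a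
geometric majorant of ratio `(2/N)^a`. -/
lemma summable_mul_rising {a : ℝ} (ha : 0 < a) {N : ℕ} (hN : 2 < N) (k : ℕ) :
    Summable fun l : ℕ => (-(N : ℝ) ^ (-a)) ^ l * rising (a * l + 1) k := by
  have hN0 : (2 : ℝ) < N := by exact_mod_cast hN
  have hq : ((2 : ℝ) / N) ^ a < 1 :=
    Real.rpow_lt_one (by positivity) ((div_lt_one (by linarith)).2 hN0) ha
  refine Summable.of_norm_bounded (g := fun l : ℕ => 2 ^ k * (((2 : ℝ) / N) ^ a) ^ l)
    ((summable_geometric_of_lt_one (by positivity) hq).mul_left _) fun l => ?_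
  have hal : 0 ≤ a * l := by positivity
  have h := rising_add_one_mul_pow_le hal (z := 1 / 2) (by norm_num) (by norm_num) k
  rw [show (1 : ℝ) - 1 / 2 = 2⁻¹ by norm_num, Real.inv_rpow (by norm_num), one_div, one_div,
    inv_inv, inv_pow, ← div_eq_mul_inv, div_le_iff₀ (by positivity)] at h
  rw [norm_mul, norm_pow, norm_neg, Real.norm_of_nonneg (by positivity), rpow_neg_pow,
    Real.norm_of_nonneg (rising_nonneg (by linarith) k), inv_mul_le_iff₀ (by positivity),
    ← Real.rpow_natCast (((2 : ℝ) / N) ^ a), ← Real.rpow_mul (by positivity),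
    Real.div_rpow (by norm_num) (by positivity), mul_div_assoc', mul_div_cancel₀ _ (by positivity)]
  linarith

lemma tendsto_floor_mul_atTop {t : ℝ} (ht : 0 < t) :
    Tendsto (fun N : ℕ => ⌊t * N⌋₊) atTop atTop :=
  tendsto_nat_floor_atTop.comp (tendsto_natCast_atTop_atTop.const_mul_atTop ht)

lemma tendsto_inv_rpow_mul_rising {s : ℝ} (hs : 0 ≤ s) {t : ℝ} (ht : 0 < t) :
    Tendsto (fun N : ℕ => ((N : ℝ) ^ s)⁻¹ * rising (s + 1) ⌊t * N⌋₊) atTop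
      (𝓝 (t ^ s * (1 / Real.Gamma (1 + s)))) := by
  have h1 : Tendsto (fun N : ℕ => ((⌊t * N⌋₊ : ℝ) / N) ^ s) atTop (𝓝 (t ^ s)) :=
    ((tendsto_nat_floor_mul_div_atTop ht.le).comp tendsto_natCast_atTop_atTop).rpow_const
      (Or.inl ht.ne')
  refine (h1.mul ((tendsto_rising_div_rpow hs).comp (tendsto_floor_mul_atTop ht))).congr' ?_
  filter_upwards [(tendsto_floor_mul_atTop ht).eventually_gt_atTop 0] with N hN
  have hn : (0 : ℝ) < ⌊t * N⌋₊ := by exact_mod_cast hN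
  have hn' : (⌊t * N⌋₊ : ℝ) ^ s ≠ 0 := by positivity
  simp only [Function.comp_apply]
  rw [Real.div_rpow hn.le (by positivity)]
  field_simp

lemma tendsto_discreteTail {a : ℝ} (ha : 0 < a) {t : ℝ} (ht : 0 < t) :
    Tendsto (fun N : ℕ => PowerSeries.coeff ⌊t * N⌋₊ (discreteTail a ((N : ℝ) ^ (-a)))) atTop
      (𝓝 (mittagLeffler a 1 (-t ^ a))) := by
  -- This `R` makes the bound `rising_add_one_le` geometric in `l` with ratio `1/2`, uniformly in
  -- `N`, so that dominated convergence applies.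
  obtain ⟨R, hR, hRt⟩ : ∃ R : ℝ, 0 < R ∧ (t / R) ^ a = 1 / 2 := by
    refine ⟨2 ^ a⁻¹ * t, by positivity, ?_⟩
    rw [div_mul_cancel_right₀ ht.ne', Real.inv_rpow (by positivity),
      Real.rpow_inv_rpow (by norm_num) ha.ne']
    norm_num
  have hbound : ∀ N : ℕ, 0 < N → 2 * R < ⌊t * N⌋₊ → ∀ l : ℕ,
      ‖(-(N : ℝ) ^ (-a)) ^ l * rising (a * l + 1) ⌊t * N⌋₊‖ ≤ Real.exp (2 * R) * (1 / 2) ^ l := by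
    intro N hN hn l
    have hN0 : (0 : ℝ) < N := by exact_mod_cast hN
    have hal : 0 ≤ a * l := by positivity
    rw [norm_mul, norm_pow, norm_neg, Real.norm_of_nonneg (by positivity), rpow_neg_pow,
      Real.norm_of_nonneg (rising_nonneg (by linarith) _), inv_mul_le_iff₀ (by positivity)]
    calc rising (a * l + 1) ⌊t * N⌋₊
      _ ≤ Real.exp (2 * R) * (⌊t * N⌋₊ / R) ^ (a * l) := rising_add_one_le hal hR hn
      _ ≤ Real.exp (2 * R) * (N * (t / R)) ^ (a * l) := by
        gcongr
        rw [mul_div_assoc', mul_comm (N : ℝ) t]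
        gcongr
        exact Nat.floor_le (by positivity)
      _ = N ^ (a * l) * (Real.exp (2 * R) * (1 / 2) ^ l) := by
        rw [Real.mul_rpow (by positivity) (by positivity), Real.rpow_mul (x := t / R)
          (by positivity), hRt, Real.rpow_natCast]
        ring
  have hgeom : Summable fun l : ℕ => Real.exp (2 * R) * (1 / 2 : ℝ) ^ l :=
    (summable_geometric_of_lt_one (by norm_num) (by norm_num)).mul_left _
  have hlarge : ∀ᶠ N : ℕ in atTop, 0 < N ∧ 2 * R < ⌊t * N⌋₊ :=
    (eventually_gt_atTop 0).and
      ((tendsto_natCast_atTop_atTop.comp (tendsto_floor_mul_atTop ht)).eventually_gt_atTop (2 * R))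
  have hlim : Tendsto (fun N : ℕ => ∑' l : ℕ, (-(N : ℝ) ^ (-a)) ^ l * rising (a * l + 1) ⌊t * N⌋₊)
      atTop (𝓝 (∑' l : ℕ, (-t ^ a) ^ l / Real.Gamma (1 + a * l))) := by
    refine tendsto_tsum_of_dominated_convergence hgeom (fun l => ?_) ?_
    · have h := (tendsto_inv_rpow_mul_rising (s := a * l) (by positivity) ht).const_mul
        ((-1 : ℝ) ^ l)
      rw [show (-t ^ a) ^ l / Real.Gamma (1 + a * l)
        = (-1) ^ l * (t ^ (a * l) * (1 / Real.Gamma (1 + a * l))) by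
          rw [neg_pow, Real.rpow_mul ht.le, Real.rpow_natCast]; ring]
      refine h.congr fun N => ?_
      rw [neg_pow ((N : ℝ) ^ (-a)), rpow_neg_pow, mul_assoc]
    · filter_upwards [hlarge] with N hN
      exact hbound N hN.1 hN.2
  refine hlim.congr' ?_
  filter_upwards [eventually_gt_atTop 2] with N hN
  have hN0 : (0 : ℝ) < N := by positivity
  exact (coeff_discreteTail_eq_tsum (Real.rpow_pos_of_pos hN0 _) _ (summable_mul_rising ha hN)).symm

/-! ### Monotonicity, decay and analyticity of `E_{a,1}` on the negative half-line. -/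

lemma mittagLeffler_antitone_aux {a : ℝ} (ha : 0 < a) (ha1 : a ≤ 1) {s t : ℝ} (hs : 0 < s)
    (hst : s ≤ t) : mittagLeffler a 1 (-t ^ a) ≤ mittagLeffler a 1 (-s ^ a) := by
  refine le_of_tendsto_of_tendsto (tendsto_discreteTail ha (hs.trans_le hst))
    (tendsto_discreteTail ha hs) ?_
  filter_upwards [eventually_gt_atTop 0] with N hN
  have hN0 : (0 : ℝ) < N := by exact_mod_cast hN
  exact coeff_discreteTail_antitone (Real.rpow_pos_of_pos hN0 _) ha.le ha1
    (Nat.floor_le_floor (by gcongr))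

lemma mittagLeffler_nonneg_aux {a : ℝ} (ha : 0 < a) (ha1 : a ≤ 1) {t : ℝ} (ht : 0 < t) :
    0 ≤ mittagLeffler a 1 (-t ^ a) := by
  refine ge_of_tendsto (tendsto_discreteTail ha ht) ?_
  filter_upwards [eventually_gt_atTop 0] with N hN
  have hN0 : (0 : ℝ) < N := by exact_mod_cast hN
  exact coeff_discreteTail_nonneg (Real.rpow_pos_of_pos hN0 _) ha.le ha1 _

lemma mittagLeffler_mul_le_aux {a : ℝ} (ha : 0 < a) (ha1 : a ≤ 1) {t : ℝ} (ht : 0 < t) :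
    mittagLeffler a 1 (-t ^ a) * (1 + t ^ a * (1 / Real.Gamma (1 + a))) ≤ 1 := by
  refine le_of_tendsto ((tendsto_discreteTail ha ht).mul
    ((tendsto_inv_rpow_mul_rising ha.le ht).const_add 1)) ?_
  filter_upwards [eventually_gt_atTop 0] with N hN
  have hN0 : (0 : ℝ) < N := by exact_mod_cast hN
  have := coeff_discreteTail_mul_le (Real.rpow_pos_of_pos hN0 (-a)) ha.le ha1 ⌊t * N⌋₊
  rwa [Real.rpow_neg hN0.le] at this ⊢

lemma mittagLeffler_zero (a : ℝ) : mittagLeffler a 1 0 = 1 := by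
  rw [mittagLeffler, tsum_eq_single 0 fun l hl => by simp [hl]]
  simp

/-- The function `x ↦ E_{a,1}(-x)` is nonincreasing on the half-line. -/
lemma antitoneOn_mittagLeffler {a : ℝ} (ha : 0 < a) (ha1 : a ≤ 1) :
    AntitoneOn (fun x => mittagLeffler a 1 (-x)) (Set.Ici 0) := by
  have key : ∀ x : ℝ, 0 < x → (x ^ a⁻¹) ^ a = x := fun x hx => Real.rpow_inv_rpow hx.le ha.ne'
  intro x hx y hy hxy
  rcases (Set.mem_Ici.1 hx).eq_or_lt with rfl | hx0
  · rcases (Set.mem_Ici.1 hy).eq_or_lt with rfl | hy0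
    · exact le_rfl
    · have h := mittagLeffler_mul_le_aux ha ha1 (Real.rpow_pos_of_pos hy0 a⁻¹)
      have h0 := mittagLeffler_nonneg_aux ha ha1 (Real.rpow_pos_of_pos hy0 a⁻¹)
      rw [key y hy0] at h h0
      have hG : 0 < Real.Gamma (1 + a) := Real.Gamma_pos_of_pos (by linarith)
      have : 0 ≤ mittagLeffler a 1 (-y) * (y * (1 / Real.Gamma (1 + a))) := by positivity
      simp only [neg_zero, mittagLeffler_zero]
      linarith
  · have h := mittagLeffler_antitone_aux ha ha1 (Real.rpow_pos_of_pos hx0 a⁻¹)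
      (Real.rpow_le_rpow hx0.le hxy (by positivity) : x ^ a⁻¹ ≤ y ^ a⁻¹)
    rwa [key x hx0, key y (hx0.trans_le hxy)] at h

lemma mittagLeffler_neg_nonneg {a : ℝ} (ha : 0 < a) (ha1 : a ≤ 1) {x : ℝ} (hx : 0 ≤ x) :
    0 ≤ mittagLeffler a 1 (-x) := by
  rcases hx.eq_or_lt with rfl | hx0
  · simp [mittagLeffler_zero]
  · have h := mittagLeffler_nonneg_aux ha ha1 (Real.rpow_pos_of_pos hx0 a⁻¹)
    rwa [Real.rpow_inv_rpow hx0.le ha.ne'] at h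

lemma mittagLeffler_neg_le {a : ℝ} (ha : 0 < a) (ha1 : a ≤ 1) {x : ℝ} (hx : 0 < x) :
    mittagLeffler a 1 (-x) ≤ 1 / (1 + x / Real.Gamma (1 + a)) := by
  have hG : 0 < Real.Gamma (1 + a) := Real.Gamma_pos_of_pos (by linarith)
  have h := mittagLeffler_mul_le_aux ha ha1 (Real.rpow_pos_of_pos hx a⁻¹)
  rw [Real.rpow_inv_rpow hx.le ha.ne', mul_one_div] at h
  rwa [le_div_iff₀ (by positivity)]

lemma tendsto_mittagLeffler_neg {a : ℝ} (ha : 0 < a) (ha1 : a ≤ 1) :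
    Tendsto (fun x => mittagLeffler a 1 (-x)) atTop (𝓝 0) := by
  have hG : 0 < Real.Gamma (1 + a) := Real.Gamma_pos_of_pos (by linarith)
  have h : Tendsto (fun x : ℝ => 1 / (1 + x / Real.Gamma (1 + a))) atTop (𝓝 0) := by
    simp only [one_div]
    exact (tendsto_atTop_add_const_left _ _ (tendsto_id.atTop_div_const hG)).inv_tendsto_atTop
  refine tendsto_of_tendsto_of_tendsto_of_le_of_le' tendsto_const_nhds h ?_ ?_
  · filter_upwards [eventually_ge_atTop 0] with x hx using mittagLeffler_neg_nonneg ha ha1 hx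
  · filter_upwards [eventually_gt_atTop 0] with x hx using mittagLeffler_neg_le ha ha1 hx

/-- Restrict the Gamma integral to `x > R`, where `x ^ s ≥ R ^ s`. As `R` is free, `Γ(1 + a l)`
outgrows every geometric sequence in `l`. -/
lemma exp_neg_mul_rpow_le_Gamma {R s : ℝ} (hR : 0 < R) (hs : 0 ≤ s) :
    Real.exp (-R) * R ^ s ≤ Real.Gamma (1 + s) := by
  rw [Real.Gamma_eq_integral (by linarith)]
  have hint := Real.GammaIntegral_convergent (s := 1 + s) (by linarith)
  calc Real.exp (-R) * R ^ s = ∫ x in Set.Ioi R, Real.exp (-x) * R ^ s := by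
        rw [integral_mul_const, integral_exp_neg_Ioi]
    _ ≤ ∫ x in Set.Ioi R, Real.exp (-x) * x ^ (1 + s - 1) := by
        refine setIntegral_mono_on ((integrableOn_exp_neg_Ioi R).mul_const _)
          (hint.mono_set (Set.Ioi_subset_Ioi hR.le)) measurableSet_Ioi fun x hx => ?_
        rw [add_sub_cancel_left]
        have := Set.mem_Ioi.1 hx
        gcongr
    _ ≤ ∫ x in Set.Ioi 0, Real.exp (-x) * x ^ (1 + s - 1) :=
        setIntegral_mono_set hint ((ae_restrict_iff' measurableSet_Ioi).2 (ae_of_all _ fun x hx => by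
          have := Set.mem_Ioi.1 hx
          simp only [Pi.zero_apply]
          positivity)) (Set.Ioi_subset_Ioi hR.le).eventuallyLE

lemma summable_mittagLeffler_coeff {a : ℝ} (ha : 0 < a) {r : ℝ} (hr : 0 < r) :
    Summable fun l : ℕ => (Real.Gamma (1 + a * l))⁻¹ * r ^ l := by
  obtain ⟨R, hR, hRr⟩ : ∃ R : ℝ, 0 < R ∧ R ^ a = 2 * r :=
    ⟨(2 * r) ^ a⁻¹, by positivity, Real.rpow_inv_rpow (by positivity) ha.ne'⟩
  refine Summable.of_nonneg_of_le (fun l => ?_) (fun l => ?_)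
    ((summable_geometric_of_lt_one (r := 1 / 2) (by norm_num) (by norm_num)).mul_left (Real.exp R))
  · have := Real.Gamma_pos_of_pos (show 0 < 1 + a * l by positivity)
    positivity
  · have hG := Real.Gamma_pos_of_pos (show 0 < 1 + a * l by positivity)
    have h := exp_neg_mul_rpow_le_Gamma hR (show 0 ≤ a * l by positivity)
    rw [Real.rpow_mul hR.le, hRr, Real.rpow_natCast] at h
    rw [inv_mul_le_iff₀ hG]
    calc r ^ l = (Real.exp (-R) * (2 * r) ^ l) * (Real.exp R * (1 / 2) ^ l) := by
          rw [mul_mul_mul_comm, ← Real.exp_add, ← mul_pow, neg_add_cancel, Real.exp_zero, one_mul]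
          congr 1; ring
      _ ≤ _ := by gcongr

lemma analyticOnNhd_mittagLeffler {a : ℝ} (ha : 0 < a) :
    AnalyticOnNhd ℝ (mittagLeffler a 1) Set.univ := by
  set p := FormalMultilinearSeries.ofScalars ℝ (𝕜 := ℝ) fun l : ℕ => (Real.Gamma (1 + a * l))⁻¹
  have hrad : p.radius = ⊤ := by
    refine p.radius_eq_top_of_summable_norm fun r => ?_
    refine Summable.of_nonneg_of_le (fun n => by positivity) (fun n => ?_)
      (summable_mittagLeffler_coeff ha (r := r + 1) (by positivity))
    have hG := Real.Gamma_pos_of_pos (show 0 < 1 + a * n by positivity)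
    rw [FormalMultilinearSeries.ofScalars_norm, Real.norm_of_nonneg (by positivity)]
    gcongr
    linarith
  have h := p.hasFPowerSeriesOnBall (by rw [hrad]; exact ENNReal.coe_lt_top)
  have hsum : p.sum = mittagLeffler a 1 := by
    ext z
    simp only [FormalMultilinearSeries.sum, p, FormalMultilinearSeries.ofScalars_apply_eq,
      mittagLeffler, smul_eq_mul]
    exact tsum_congr fun l => by rw [div_eq_inv_mul]
  rw [hsum, hrad] at h
  intro z _
  exact h.analyticAt_of_mem (by simp)

/-- Equal values at two points would force constancy between them by monotonicity, hence everywhere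
by the identity theorem. But the value is `1` at `0` and smaller than `1` at `-1`. -/
lemma strictAntiOn_mittagLeffler {a : ℝ} (ha : 0 < a) (ha1 : a ≤ 1) :
    StrictAntiOn (fun x => mittagLeffler a 1 (-x)) (Set.Ici 0) := by
  have hanti := antitoneOn_mittagLeffler ha ha1
  have hG : 0 < Real.Gamma (1 + a) := Real.Gamma_pos_of_pos (by linarith)
  intro x hx y hy hxy
  refine lt_of_le_of_ne (hanti hx hy hxy.le) fun heq => ?_
  have hx0 := Set.mem_Ici.1 hx
  have hconst : ∀ w ∈ Set.Ioo x y, mittagLeffler a 1 (-w) = mittagLeffler a 1 (-x) := by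
    intro w hw
    have hw0 : w ∈ Set.Ici (0 : ℝ) := hx0.trans hw.1.le
    exact le_antisymm (hanti hx hw0 hw.1.le) (heq.symm.le.trans (hanti hw0 hy hw.2.le))
  obtain ⟨m, hm⟩ := exists_between hxy
  have hall := (analyticOnNhd_mittagLeffler ha).eqOn_of_preconnected_of_eventuallyEq
    (g := fun _ => mittagLeffler a 1 (-x)) analyticOnNhd_const isPreconnected_univ
    (Set.mem_univ (-m)) (by
      filter_upwards [Ioo_mem_nhds (neg_lt_neg hm.2) (neg_lt_neg hm.1)] with w hw
      have := hconst (-w) ⟨by linarith [hw.2], by linarith [hw.1]⟩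
      rwa [neg_neg] at this)
  have h0 := hall (Set.mem_univ 0)
  have h1 := hall (Set.mem_univ (-1))
  have h2 := mittagLeffler_neg_le ha ha1 one_pos
  rw [mittagLeffler_zero] at h0
  simp only at h0 h1
  rw [h1, ← h0, le_div_iff₀ (by positivity)] at h2
  have : 0 < 1 / Real.Gamma (1 + a) := by positivity
  linarith

/-! ### The Mittag-Leffler law and the arrival probability. -/

section

/-- Cutting off at `0` absorbs the case split because `E_{a,1}(0) = 1`; continuity and monotonicity
then follow by composition. -/
lemma mittagLefflerCDF_eq {a : ℝ} (ha : 0 < a) (t : ℝ) :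
    mittagLefflerCDF a 1 t = 1 - mittagLeffler a 1 (-(max t 0) ^ a) := by
  rw [mittagLefflerCDF]
  split_ifs with h
  · rw [max_eq_right h.le, Real.zero_rpow ha.ne', neg_zero, mittagLeffler_zero, sub_self]
  · rw [max_eq_left (not_lt.1 h), one_mul]

lemma mittagLefflerCDF_scale {r : ℝ} (hr : 0 < r) (a t : ℝ) :
    mittagLefflerCDF a r t = mittagLefflerCDF a 1 (r * t) := by
  simp only [mittagLefflerCDF, mul_neg_iff, hr, hr.not_gt, true_and, false_and, or_false, one_mul]

lemma mittagLefflerCDF_of_nonpos {a : ℝ} (ha : 0 < a) {t : ℝ} (ht : t ≤ 0) :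
    mittagLefflerCDF a 1 t = 0 := by
  rw [mittagLefflerCDF_eq ha, max_eq_right ht, Real.zero_rpow ha.ne', neg_zero,
    mittagLeffler_zero, sub_self]

lemma continuous_mittagLefflerCDF {a : ℝ} (ha : 0 < a) : Continuous (mittagLefflerCDF a 1) := by
  have h : Continuous (mittagLeffler a 1) :=
    continuousOn_univ.1 (analyticOnNhd_mittagLeffler ha).continuousOn
  rw [funext (mittagLefflerCDF_eq ha)]
  exact continuous_const.sub (h.comp
    ((continuous_id.max continuous_const).rpow_const fun _ => Or.inr ha.le).neg)

lemma strictMonoOn_mittagLefflerCDF {a : ℝ} (ha : 0 < a) (ha1 : a ≤ 1) :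
    StrictMonoOn (mittagLefflerCDF a 1) (Set.Ici 0) := by
  intro s hs t ht hst
  have hs0 := Set.mem_Ici.1 hs
  have ht0 := Set.mem_Ici.1 ht
  rw [mittagLefflerCDF_eq ha, mittagLefflerCDF_eq ha, max_eq_left hs0, max_eq_left ht0]
  exact sub_lt_sub_left (strictAntiOn_mittagLeffler ha ha1 (Real.rpow_nonneg hs0 a)
    (Real.rpow_nonneg ht0 a) (Real.rpow_lt_rpow hs0 hst ha)) 1

lemma monotone_mittagLefflerCDF {a : ℝ} (ha : 0 < a) (ha1 : a ≤ 1) :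
    Monotone (mittagLefflerCDF a 1) := by
  intro s t hst
  rw [mittagLefflerCDF_eq ha, mittagLefflerCDF_eq ha]
  refine sub_le_sub_left (antitoneOn_mittagLeffler ha ha1 ?_ ?_ ?_) 1
  · exact Real.rpow_nonneg (le_max_right _ _) a
  · exact Real.rpow_nonneg (le_max_right _ _) a
  · exact Real.rpow_le_rpow (le_max_right _ _) (max_le_max_right 0 hst) ha.le

lemma tendsto_mittagLefflerCDF_atTop {a : ℝ} (ha : 0 < a) (ha1 : a ≤ 1) :
    Tendsto (mittagLefflerCDF a 1) atTop (𝓝 1) := by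
  have h := ((tendsto_mittagLeffler_neg ha ha1).comp (tendsto_rpow_atTop ha)).const_sub 1
  rw [sub_zero] at h
  refine h.congr' ?_
  filter_upwards [eventually_ge_atTop 0] with t ht
  rw [mittagLefflerCDF_eq ha, max_eq_left ht, Function.comp_apply]

lemma mittagLefflerCDF_nonneg {a : ℝ} (ha : 0 < a) (ha1 : a ≤ 1) (t : ℝ) :
    0 ≤ mittagLefflerCDF a 1 t := by
  rcases le_total t 0 with ht | ht
  · rw [mittagLefflerCDF_of_nonpos ha ht]
  · rw [← mittagLefflerCDF_of_nonpos ha le_rfl]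
    exact monotone_mittagLefflerCDF ha ha1 ht

lemma mittagLefflerCDF_le_one {a : ℝ} (ha : 0 < a) (ha1 : a ≤ 1) (t : ℝ) :
    mittagLefflerCDF a 1 t ≤ 1 :=
  (monotone_mittagLefflerCDF ha ha1).ge_of_tendsto (tendsto_mittagLefflerCDF_atTop ha ha1) t

/-- The Mittag-Leffler law of scale one exists. -/
lemma exists_mittagLefflerLaw {a : ℝ} (ha : 0 < a) (ha1 : a ≤ 1) :
    ∃ ν : Measure ℝ, IsProbabilityMeasure ν ∧ ∀ t, cdf ν t = mittagLefflerCDF a 1 t := by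
  let f : StieltjesFunction ℝ :=
    ⟨mittagLefflerCDF a 1, monotone_mittagLefflerCDF ha ha1,
      fun t => (continuous_mittagLefflerCDF ha).continuousWithinAt⟩
  have h0 : Tendsto f atBot (𝓝 0) := by
    refine tendsto_const_nhds.congr' ?_
    filter_upwards [eventually_le_atBot 0] with t ht
    exact (mittagLefflerCDF_of_nonpos ha ht).symm
  have h1 : Tendsto f atTop (𝓝 1) := tendsto_mittagLefflerCDF_atTop ha ha1
  refine ⟨f.measure, ⟨by rw [f.measure_univ h0 h1, sub_zero, ENNReal.ofReal_one]⟩, fun t => ?_⟩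
  rw [cdf_measure_stieltjesFunction f h0 h1]

lemma ae_pos_of_cdf_eq {b : ℝ} (hb : 0 < b) {ν : Measure ℝ} [IsProbabilityMeasure ν]
    (hν : ∀ t, cdf ν t = mittagLefflerCDF b 1 t) : ∀ᵐ y ∂ν, 0 < y := by
  have h : ν (Set.Iic 0) = 0 := by
    rw [← ofReal_cdf, hν, mittagLefflerCDF_of_nonpos hb le_rfl, ENNReal.ofReal_zero]
  rw [ae_iff]
  convert h using 2
  ext y; simp

section ArrivalProbability

variable {a b : ℝ} {ν : Measure ℝ} [IsProbabilityMeasure ν]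

lemma integrable_mittagLefflerCDF_mul (ha : 0 < a) (ha1 : a ≤ 1) (r : ℝ) :
    Integrable (fun y => mittagLefflerCDF a 1 (r * y)) ν := by
  have hc : Continuous fun y => mittagLefflerCDF a 1 (r * y) :=
    (continuous_mittagLefflerCDF ha).comp (continuous_const.mul continuous_id)
  refine Integrable.of_bound hc.aestronglyMeasurable 1 (ae_of_all _ fun y => ?_)
  rw [Real.norm_of_nonneg (mittagLefflerCDF_nonneg ha ha1 _)]
  exact mittagLefflerCDF_le_one ha ha1 _

lemma continuous_arrivalProb (ha : 0 < a) (ha1 : a ≤ 1) :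
    Continuous fun r => ∫ y, mittagLefflerCDF a 1 (r * y) ∂ν := by
  refine continuous_of_dominated (bound := fun _ => 1)
    (fun r => (integrable_mittagLefflerCDF_mul ha ha1 r).aestronglyMeasurable)
    (fun r => ae_of_all _ fun y => ?_) (integrable_const 1) (ae_of_all _ fun y => ?_)
  · rw [Real.norm_of_nonneg (mittagLefflerCDF_nonneg ha ha1 _)]
    exact mittagLefflerCDF_le_one ha ha1 _
  · exact (continuous_mittagLefflerCDF ha).comp (continuous_id.mul continuous_const)

lemma tendsto_arrivalProb_atTop (ha : 0 < a) (ha1 : a ≤ 1) (hν : ∀ᵐ y ∂ν, 0 < y) :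
    Tendsto (fun r => ∫ y, mittagLefflerCDF a 1 (r * y) ∂ν) atTop (𝓝 1) := by
  have h1 : ∫ _, (1 : ℝ) ∂ν = 1 := by simp
  -- Writing the limit `1` as an integral also changes the scale argument of the cdf, which the
  -- second rewrite restores.
  rw [← h1, show mittagLefflerCDF a (∫ _, (1 : ℝ) ∂ν) = mittagLefflerCDF a 1 by rw [h1]]
  refine tendsto_integral_filter_of_dominated_convergence (fun _ => 1)
    (Eventually.of_forall fun r => (integrable_mittagLefflerCDF_mul ha ha1 r).aestronglyMeasurable)
    (Eventually.of_forall fun r => ae_of_all _ fun y => ?_) (integrable_const 1) ?_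
  · rw [Real.norm_of_nonneg (mittagLefflerCDF_nonneg ha ha1 _)]
    exact mittagLefflerCDF_le_one ha ha1 _
  · filter_upwards [hν] with y hy
    exact (tendsto_mittagLefflerCDF_atTop ha ha1).comp (tendsto_id.atTop_mul_const hy)

lemma strictMonoOn_arrivalProb (ha : 0 < a) (ha1 : a ≤ 1) (hν : ∀ᵐ y ∂ν, 0 < y) :
    StrictMonoOn (fun r => ∫ y, mittagLefflerCDF a 1 (r * y) ∂ν) (Set.Ici 0) := by
  intro r hr s hs hrs
  have hlt : ∀ᵐ y ∂ν, mittagLefflerCDF a 1 (r * y) < mittagLefflerCDF a 1 (s * y) := by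
    filter_upwards [hν] with y hy
    exact strictMonoOn_mittagLefflerCDF ha ha1 (mul_nonneg hr hy.le) (mul_nonneg hs hy.le)
      (mul_lt_mul_of_pos_right hrs hy)
  have hint := (integrable_mittagLefflerCDF_mul (ν := ν) ha ha1 s).sub
    (integrable_mittagLefflerCDF_mul ha ha1 r)
  rw [← sub_pos, ← integral_sub (integrable_mittagLefflerCDF_mul ha ha1 s)
    (integrable_mittagLefflerCDF_mul ha ha1 r)]
  refine (integral_pos_iff_support_of_nonneg_ae
    (hlt.mono fun y hy => (sub_pos.2 hy).le) hint).2 ?_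
  have : Function.support (fun y => mittagLefflerCDF a 1 (s * y) - mittagLefflerCDF a 1 (r * y))
      =ᵐ[ν] Set.univ := by
    rw [eventuallyEq_univ]
    filter_upwards [hlt] with y hy
    exact (sub_pos.2 hy).ne'
  rw [measure_congr this, measure_univ]
  exact one_pos

end ArrivalProbability

lemma IsMittagLefflerClocks.indepFun_left_right {Ω : Type*} [MeasurableSpace Ω] {P : Measure Ω}
    {a b lam mu : ℝ} {X Y : ℕ → Ω → ℝ} (h : IsMittagLefflerClocks P a b lam mu X Y) (n : ℕ) :
    IndepFun (X n) (Y n) P :=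
  h.indep.indepFun (i := Sum.inl n) (j := Sum.inr n) (by simp)

/-- Condition on `Y n` by Fubini. The cdf of `X n` is continuous, so the strict inequality costs
nothing, and `mu * Y n` has law `ν`, which leaves only the ratio of the scales. -/
lemma IsMittagLefflerClocks.real_lt_eq_integral {Ω : Type*} [MeasurableSpace Ω] {P : Measure Ω}
    [IsProbabilityMeasure P] {a b lam mu : ℝ} (ha : 0 < a) (ha1 : a ≤ 1) (hlam : 0 < lam)
    (hmu : 0 < mu) {X Y : ℕ → Ω → ℝ} (h : IsMittagLefflerClocks P a b lam mu X Y)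
    {ν : Measure ℝ} [IsProbabilityMeasure ν] (hν : ∀ t, cdf ν t = mittagLefflerCDF b 1 t) (n : ℕ) :
    P.real {ω | X n ω < Y n ω} = ∫ y, mittagLefflerCDF a 1 (lam / mu * y) ∂ν := by
  have hX := h.measurable_left n
  have hY := h.measurable_right n
  have hmY : Measurable fun ω => mu * Y n ω := hY.const_mul mu
  have := Measure.isProbabilityMeasure_map (μ := P) hX.aemeasurable
  have := Measure.isProbabilityMeasure_map (μ := P) hY.aemeasurable
  have := Measure.isProbabilityMeasure_map (μ := P) hmY.aemeasurable
  have hlaw : ν = P.map fun ω => mu * Y n ω := by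
    refine Measure.eq_of_cdf _ _ (StieltjesFunction.ext fun t => ?_)
    rw [hν, cdf_eq_real, map_measureReal_apply hmY measurableSet_Iic]
    have : (fun ω => mu * Y n ω) ⁻¹' Set.Iic t = {ω | Y n ω ≤ t / mu} := by
      ext ω; simp [le_div_iff₀ hmu, mul_comm]
    rw [this, h.cdf_right, mittagLefflerCDF_scale hmu, mul_div_cancel₀ _ hmu.ne']
  have hcdf : ∀ t, cdf (P.map (X n)) t = mittagLefflerCDF a 1 (lam * t) := fun t => by
    rw [cdf_eq_real, map_measureReal_apply hX measurableSet_Iic, ← mittagLefflerCDF_scale hlam]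
    exact h.cdf_left n t
  have hcont : Continuous fun t => mittagLefflerCDF a 1 (lam * t) :=
    (continuous_mittagLefflerCDF ha).comp (continuous_const.mul continuous_id)
  have hIio : ∀ y, P.map (X n) (Set.Iio y) = ENNReal.ofReal (mittagLefflerCDF a 1 (lam * y)) := by
    intro y
    rw [← measure_cdf (P.map (X n)), StieltjesFunction.measure_Iio _ (tendsto_cdf_atBot _),
      sub_zero]
    congr 1
    have hc : Continuous (cdf (P.map (X n))) := by rw [funext hcdf]; exact hcont
    rw [hc.continuousAt.continuousWithinAt.leftLim_eq, hcdf]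
  have hS : MeasurableSet {q : ℝ × ℝ | q.1 < q.2} := measurableSet_lt measurable_fst measurable_snd
  have hint : Integrable (fun y => mittagLefflerCDF a 1 (lam * y)) (P.map (Y n)) :=
    integrable_mittagLefflerCDF_mul ha ha1 lam
  have hP : P {ω | X n ω < Y n ω} =
      ENNReal.ofReal (∫ y, mittagLefflerCDF a 1 (lam * y) ∂(P.map (Y n))) := by
    rw [ofReal_integral_eq_lintegral_ofReal hint
      (ae_of_all _ fun y => mittagLefflerCDF_nonneg ha ha1 _)]
    simp_rw [← hIio]
    have h1 := (indepFun_iff_map_prod_eq_prod_map_map hX.aemeasurable hY.aemeasurable).1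
      (h.indepFun_left_right n)
    have h2 : P {ω | X n ω < Y n ω}
        = P.map (fun ω => (X n ω, Y n ω)) {q : ℝ × ℝ | q.1 < q.2} := by
      rw [Measure.map_apply (hX.prodMk hY) hS]; rfl
    rw [h2, h1, Measure.prod_apply_symm hS]
    rfl
  rw [measureReal_def, hP, ENNReal.toReal_ofReal
    (integral_nonneg fun y => mittagLefflerCDF_nonneg ha ha1 _), hlaw,
    integral_map hY.aemeasurable hint.aestronglyMeasurable, integral_map hmY.aemeasurable
      (integrable_mittagLefflerCDF_mul ha ha1 _).aestronglyMeasurable]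
  congr! 3 with ω
  field_simp

/-- The ratio of the scales at which arrivals and departure attempts are equally likely. -/
lemma exists_criticalRatio {a b : ℝ} (ha : a ∈ Set.Ioo (0 : ℝ) 1) (hb : b ∈ Set.Ioo (0 : ℝ) 1) :
    ∃ ρ : ℝ, 0 < ρ ∧ ∀ lam mu : ℝ, 0 < lam → 0 < mu →
      ∀ (Ω : Type*) [MeasurableSpace Ω] (P : Measure Ω) [IsProbabilityMeasure P]
        (X Y : ℕ → Ω → ℝ), IsMittagLefflerClocks P a b lam mu X Y →
        ∃ p : ℝ, 0 < p ∧ p < 1 ∧ (∀ n, P.real {ω | X n ω < Y n ω} = p) ∧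
          (p < 1 / 2 ↔ lam / mu < ρ) ∧ (p = 1 / 2 ↔ lam / mu = ρ) := by
  obtain ⟨ν, _, hν⟩ := exists_mittagLefflerLaw hb.1 hb.2.le
  have hpos := ae_pos_of_cdf_eq hb.1 hν
  set f : ℝ → ℝ := fun r => ∫ y, mittagLefflerCDF a 1 (r * y) ∂ν with hf
  have hmono : StrictMonoOn f (Set.Ici 0) := strictMonoOn_arrivalProb ha.1 ha.2.le hpos
  have hcont : Continuous f := continuous_arrivalProb ha.1 ha.2.le
  have hlim : Tendsto f atTop (𝓝 1) := tendsto_arrivalProb_atTop ha.1 ha.2.le hpos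
  have hf0 : f 0 = 0 := by simp [hf, mittagLefflerCDF_of_nonpos ha.1]
  obtain ⟨s, hs, hs0⟩ : ∃ s, 1 / 2 < f s ∧ 0 ≤ s :=
    ((hlim.eventually_const_lt (by norm_num : (1 / 2 : ℝ) < 1)).and (eventually_ge_atTop 0)).exists
  obtain ⟨ρ, hρ, hfρ⟩ := intermediate_value_Icc hs0 hcont.continuousOn
    (show (1 / 2 : ℝ) ∈ Set.Icc (f 0) (f s) from ⟨by rw [hf0]; norm_num, hs.le⟩)
  have hρ0 : 0 < ρ := by
    refine lt_of_le_of_ne hρ.1 fun h => ?_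
    rw [← h, hf0] at hfρ
    norm_num at hfρ
  refine ⟨ρ, hρ0, fun lam mu hlam hmu Ω _ P _ X Y h => ⟨f (lam / mu), ?_, ?_, ?_, ?_, ?_⟩⟩
  · rw [← hf0]
    exact hmono Set.self_mem_Ici (div_pos hlam hmu).le (div_pos hlam hmu)
  -- To get `p < 1` strictly, compare with the larger argument `lam / mu + 1`, where `f` is still at
  -- most `1`.
  · refine (hmono (div_pos hlam hmu).le (div_pos hlam hmu |>.le.trans (le_add_of_nonneg_right
      zero_le_one)) (lt_add_one _)).trans_le ?_
    calc f (lam / mu + 1) ≤ ∫ _, 1 ∂ν :=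
          integral_mono (integrable_mittagLefflerCDF_mul ha.1 ha.2.le _) (integrable_const 1)
            fun y => mittagLefflerCDF_le_one ha.1 ha.2.le _
      _ = 1 := by simp
  · exact h.real_lt_eq_integral ha.1 ha.2.le hlam hmu hν
  · rw [← hfρ]
    exact hmono.lt_iff_lt (div_pos hlam hmu).le hρ0.le
  · rw [← hfρ]
    exact hmono.eq_iff_eq (div_pos hlam hmu).le hρ0.le

end

/-! ### Pathwise comparison of the queue, the reversed queue and the random walk. -/

section

variable {Ω : Type*}

/-- The effect of one event on the queue length: `+1` for an arrival, `-1` for a departure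
attempt. -/
noncomputable def step (X Y : ℕ → Ω → ℝ) (n : ℕ) (ω : Ω) : ℤ := if X n ω < Y n ω then 1 else -1

/-- The random walk with increments `step`. -/
noncomputable def walk (X Y : ℕ → Ω → ℝ) (n : ℕ) (ω : Ω) : ℤ :=
  ∑ k ∈ Finset.range n, step X Y k ω

/-- The running maximum of `walk`. -/
noncomputable def walkMax (X Y : ℕ → Ω → ℝ) : ℕ → Ω → ℤ
  | 0, _ => 0
  | n + 1, ω => max (walkMax X Y n ω) (walk X Y (n + 1) ω)

/-- The queue length after `n` events, when the first `n` events act in reversed order. -/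
noncomputable def revQueue (X Y : ℕ → Ω → ℝ) : ℕ → ℕ → Ω → ℕ
  | 0, i, _ => i
  | n + 1, i, ω => revQueue X Y n (if X n ω < Y n ω then i + 1 else i - 1) ω

variable (X Y : ℕ → Ω → ℝ) (ω : Ω)

lemma walk_succ (n : ℕ) : walk X Y (n + 1) ω = walk X Y n ω + step X Y n ω :=
  Finset.sum_range_succ _ _

@[simp] lemma walk_zero : walk X Y 0 ω = 0 := rfl

lemma step_eq_or (n : ℕ) : step X Y n ω = 1 ∨ step X Y n ω = -1 := by
  rw [step]; split_ifs <;> simp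

lemma embeddedQueue_succ_cast (i n : ℕ) : (embeddedQueue X Y i (n + 1) ω : ℤ) =
    max (embeddedQueue X Y i n ω + step X Y n ω) 0 := by
  rw [embeddedQueue, step]
  split_ifs <;> push_cast <;> omega

lemma add_walk_le_embeddedQueue (i n : ℕ) :
    (i : ℤ) + walk X Y n ω ≤ embeddedQueue X Y i n ω := by
  induction n with
  | zero => simp [embeddedQueue]
  | succ n ih =>
    rw [embeddedQueue_succ_cast, walk_succ]
    exact le_max_of_le_left (by linarith)

lemma embeddedQueue_succ' (i n : ℕ) : embeddedQueue X Y i (n + 1) ω =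
    embeddedQueue (fun k => X (k + 1)) (fun k => Y (k + 1))
      (if X 0 ω < Y 0 ω then i + 1 else i - 1) n ω := by
  induction n with
  | zero => rfl
  | succ n ih => rw [embeddedQueue, ih]; rfl

/-- Agreement is required only on the first `m` indices, so that after the first event is removed
the shifted clocks satisfy the same hypothesis for `m - 1`. -/
lemma embeddedQueue_eq_revQueue {X' Y' : ℕ → Ω → ℝ} (m i : ℕ)
    (hX : ∀ k < m, X' k ω = X (m - 1 - k) ω) (hY : ∀ k < m, Y' k ω = Y (m - 1 - k) ω) :
    embeddedQueue X' Y' i m ω = revQueue X Y m i ω := by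
  induction m generalizing i X' Y' with
  | zero => rfl
  | succ m ih =>
    rw [embeddedQueue_succ', revQueue, hX 0 m.succ_pos, hY 0 m.succ_pos]
    refine ih _ (fun k hk => ?_) fun k hk => ?_
    · rw [hX (k + 1) (by omega)]; congr 1; omega
    · rw [hY (k + 1) (by omega)]; congr 1; omega

lemma walk_le_walkMax (n : ℕ) : walk X Y n ω ≤ walkMax X Y n ω := by
  cases n with
  | zero => simp [walkMax]
  | succ n => exact le_max_right _ _

lemma walkMax_nonneg (n : ℕ) : 0 ≤ walkMax X Y n ω := by
  induction n with
  | zero => simp [walkMax]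
  | succ n ih => exact le_max_of_le_left ih

/-- Each event acts by `x ↦ max (x + s) 0`. In reversed order a new event acts first, on the initial
state, so `i` enters only through `i + walk`, while the truncations accumulate in a running maximum.
-/
lemma revQueue_eq_max (n i : ℕ) :
    (revQueue X Y n i ω : ℤ) = max (i + walk X Y n ω) (walkMax X Y n ω) := by
  induction n generalizing i with
  | zero => simp [revQueue, walkMax]
  | succ n ih =>
    have h := walk_le_walkMax X Y ω n
    rw [revQueue, ih, walkMax, walk_succ, step]
    split_ifs <;> push_cast <;> omega

/-- Once the walk stays nonpositive, its running maximum, which is at least `0`, is frozen; later `i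
+ walk` drops below it for good. The constant does not depend on `i`. -/
lemma exists_eventually_revQueue_eq
    (h : Tendsto (fun n => walk X Y n ω) atTop atBot) :
    ∃ c : ℕ, ∀ i, ∀ᶠ n in atTop, revQueue X Y n i ω = c := by
  obtain ⟨N, hN⟩ := eventually_atTop.1 (h.eventually_le_atBot 0)
  have hmax : ∀ n ≥ N, walkMax X Y n ω = walkMax X Y N ω := by
    intro n hn
    induction n, hn using Nat.le_induction with
    | base => rfl
    | succ n hn ih =>
      rw [walkMax, ih]
      exact max_eq_left ((hN _ (by omega)).trans (walkMax_nonneg X Y ω N))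
  refine ⟨(walkMax X Y N ω).toNat, fun i => ?_⟩
  filter_upwards [eventually_ge_atTop N, h.eventually_le_atBot (-i)] with n hn hi
  have h1 := revQueue_eq_max X Y ω n i
  have h2 := walkMax_nonneg X Y ω N
  rw [hmax n hn, max_eq_right (by omega)] at h1
  omega

/-- The queue is empty infinitely often if the walk is unbounded below. -/
lemma frequently_embeddedQueue_eq_zero (i : ℕ)
    (h : ¬ BddBelow (Set.range fun n => walk X Y n ω)) :
    ∃ᶠ n in atTop, embeddedQueue X Y i n ω = 0 := by
  rw [frequently_atTop]
  intro N
  by_contra! hcon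
  -- While the queue stays positive no truncation occurs, so it moves in parallel with the walk,
  -- which is then bounded below.
  have key : ∀ n ≥ N, (embeddedQueue X Y i n ω : ℤ) - walk X Y n ω
      = embeddedQueue X Y i N ω - walk X Y N ω := by
    intro n hn
    induction n, hn using Nat.le_induction with
    | base => rfl
    | succ n hn ih =>
      have h1 := embeddedQueue_succ_cast X Y ω i n
      have h2 := hcon (n + 1) (by omega)
      rw [walk_succ]
      omega
  refine h ?_
  have hfin : BddBelow ((fun n => walk X Y n ω) '' Set.Iio N) :=
    ((Set.finite_Iio N).image _).bddBelow
  obtain ⟨c, hc⟩ := hfin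
  refine ⟨min c (walk X Y N ω - embeddedQueue X Y i N ω), ?_⟩
  rintro _ ⟨n, rfl⟩
  rcases lt_or_ge n N with hn | hn
  · exact (min_le_left _ _).trans (hc ⟨n, hn, rfl⟩)
  · refine (min_le_right _ _).trans ?_
    have := key n hn
    simp only
    omega

lemma frequently_le_embeddedQueue (i j : ℕ)
    (h : ¬ BddAbove (Set.range fun n => walk X Y n ω)) :
    ∃ᶠ n in atTop, j ≤ embeddedQueue X Y i n ω := by
  rw [frequently_atTop]
  intro N
  by_contra! hcon
  refine h ?_
  obtain ⟨c, hc⟩ : BddAbove ((fun n => walk X Y n ω) '' Set.Iio N) :=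
    ((Set.finite_Iio N).image _).bddAbove
  refine ⟨max c j, ?_⟩
  rintro _ ⟨n, rfl⟩
  rcases lt_or_ge n N with hn | hn
  · exact (hc ⟨n, hn, rfl⟩).trans (le_max_left _ _)
  · refine le_trans ?_ (le_max_right _ _)
    have h1 := add_walk_le_embeddedQueue X Y ω i n
    have h2 := hcon n hn
    simp only
    omega

/-- A walk that is unbounded in both directions makes the queue visit every state infinitely
often. -/
lemma frequently_embeddedQueue_eq (i j : ℕ)
    (hb : ¬ BddBelow (Set.range fun n => walk X Y n ω))
    (ha : ¬ BddAbove (Set.range fun n => walk X Y n ω)) :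
    ∃ᶠ n in atTop, embeddedQueue X Y i n ω = j := by
  rw [frequently_atTop]
  intro N
  obtain ⟨m, hm, hm0⟩ := frequently_atTop.1 (frequently_embeddedQueue_eq_zero X Y ω i hb) N
  obtain ⟨n, hn, hnj⟩ := frequently_atTop.1 (frequently_le_embeddedQueue X Y ω i j ha) m
  by_contra! hcon
  -- The queue rises by at most one per event, so starting from `0` it cannot pass `j` without
  -- visiting it.
  have : ∀ k ≥ m, embeddedQueue X Y i k ω < j := by
    intro k hk
    induction k, hk using Nat.le_induction with
    | base =>
      rw [hm0]
      exact Nat.pos_of_ne_zero fun h => hcon m hm (hm0.trans h.symm)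
    | succ k hk ih =>
      have h1 := embeddedQueue_succ_cast X Y ω i k
      have h2 := step_eq_or X Y ω k
      have h3 := hcon (k + 1) (by omega)
      omega
  exact absurd hnj (not_le.2 (this n hn))

end

/-! ### I.i.d. clocks and the strong law of large numbers. -/

section

variable {Ω : Type*} [MeasurableSpace Ω] {P : Measure Ω} {X Y : ℕ → Ω → ℝ}

/-- The two clocks form an i.i.d. sequence of pairs of positive random variables, and `X` rings
before `Y` with probability `p`. -/
structure IsIIDClocks (P : Measure Ω) (X Y : ℕ → Ω → ℝ) (p : ℝ) : Prop where
  measurable_left : ∀ n, Measurable (X n)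
  measurable_right : ∀ n, Measurable (Y n)
  indep : iIndepFun (fun n ω => (X n ω, Y n ω)) P
  ident : ∀ n, P.map (fun ω => (X n ω, Y n ω)) = P.map (fun ω => (X 0 ω, Y 0 ω))
  prob : ∀ n, P.real {ω | X n ω < Y n ω} = p
  pos : ∀ n, ∀ᵐ ω ∂P, 0 < min (X n ω) (Y n ω)

/-- Two families that are jointly independent form an independent family of pairs. -/
lemma iIndepFun_prodMk_of_sumElim [IsProbabilityMeasure P] (hX : ∀ n, Measurable (X n))
    (hY : ∀ n, Measurable (Y n)) (h : iIndepFun (Sum.elim X Y : ℕ ⊕ ℕ → Ω → ℝ) P) :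
    iIndepFun (fun n ω => (X n ω, Y n ω)) P := by
  let U : ℕ × Bool → Ω → ℝ := fun q => if q.2 then X q.1 else Y q.1
  have hU : ∀ q, Measurable (U q) := by
    rintro ⟨n, _ | _⟩
    · exact hY n
    · exact hX n
  have hUind : iIndepFun U P := by
    let g : ℕ × Bool → ℕ ⊕ ℕ := fun q => if q.2 then Sum.inl q.1 else Sum.inr q.1
    have hg : Function.Injective g := by
      rintro ⟨n, _ | _⟩ ⟨m, _ | _⟩ hnm <;> simp_all [g]
    convert h.precomp hg using 1
    funext q
    obtain ⟨n, _ | _⟩ := q <;> simp [U, g]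
  -- Independence means that the joint law is a product measure, and currying the product over `ℕ ×
  -- Bool` gives a product over `ℕ` of laws of pairs.
  have hV : iIndepFun (fun n ω (c : Bool) => U (n, c) ω) P := by
    have hp : ∀ n c, IsProbabilityMeasure (P.map (U (n, c))) := fun n c =>
      Measure.isProbabilityMeasure_map (hU (n, c)).aemeasurable
    rw [iIndepFun_iff_map_fun_eq_infinitePi_map
      (fun n => measurable_pi_iff.2 fun c => hU (n, c))]
    have h1 := hUind.map_fun_eq_infinitePi_map hU
    have h2 := Measure.infinitePi_map_curry (fun n c => P.map (U (n, c)))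
    rw [← h1, Measure.map_map (MeasurableEquiv.measurable _) (measurable_pi_iff.2 hU)] at h2
    refine Eq.trans h2 ?_
    congr 1
    funext n
    have h3 : iIndepFun (fun c => U (n, c)) P :=
      hUind.precomp (g := fun c => (n, c)) fun c d hcd => by simpa using hcd
    exact (h3.map_fun_eq_infinitePi_map fun c => hU (n, c)).symm
  exact hV.comp (fun _ (v : Bool → ℝ) => (v true, v false)) fun _ => by fun_prop

lemma IsMittagLefflerClocks.isIIDClocks [IsProbabilityMeasure P] {a b lam mu : ℝ} (ha : 0 < a)
    (hb : 0 < b) (hlam : 0 < lam) (hmu : 0 < mu) (h : IsMittagLefflerClocks P a b lam mu X Y)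
    {p : ℝ} (hp : ∀ n, P.real {ω | X n ω < Y n ω} = p) : IsIIDClocks P X Y p where
  measurable_left := h.measurable_left
  measurable_right := h.measurable_right
  indep := iIndepFun_prodMk_of_sumElim h.measurable_left h.measurable_right h.indep
  ident n := by
    have hmap : ∀ {U V : Ω → ℝ}, Measurable U → Measurable V →
        (∀ t, P.real {ω | U ω ≤ t} = P.real {ω | V ω ≤ t}) → P.map U = P.map V := by
      intro U V hU hV hUV
      have := Measure.isProbabilityMeasure_map (μ := P) hU.aemeasurable
      have := Measure.isProbabilityMeasure_map (μ := P) hV.aemeasurable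
      refine Measure.eq_of_cdf _ _ (StieltjesFunction.ext fun t => ?_)
      rw [cdf_eq_real, cdf_eq_real, map_measureReal_apply hU measurableSet_Iic,
        map_measureReal_apply hV measurableSet_Iic]
      exact hUV t
    have hprod : ∀ k, P.map (fun ω => (X k ω, Y k ω)) = (P.map (X k)).prod (P.map (Y k)) :=
      fun k => (indepFun_iff_map_prod_eq_prod_map_map (h.measurable_left k).aemeasurable
        (h.measurable_right k).aemeasurable).1 (h.indepFun_left_right k)
    rw [hprod, hprod, hmap (h.measurable_left n) (h.measurable_left 0)
        fun t => by rw [h.cdf_left, h.cdf_left],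
      hmap (h.measurable_right n) (h.measurable_right 0)
        fun t => by rw [h.cdf_right, h.cdf_right]]
  prob := hp
  pos n := by
    have h1 : ∀ᵐ ω ∂P, 0 < X n ω := by
      have := h.cdf_left n 0
      rw [mittagLefflerCDF_scale hlam, mul_zero, mittagLefflerCDF_of_nonpos ha le_rfl,
        measureReal_eq_zero_iff] at this
      simpa [ae_iff] using this
    have h2 : ∀ᵐ ω ∂P, 0 < Y n ω := by
      have := h.cdf_right n 0
      rw [mittagLefflerCDF_scale hmu, mul_zero, mittagLefflerCDF_of_nonpos hb le_rfl,
        measureReal_eq_zero_iff] at this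
      simpa [ae_iff] using this
    filter_upwards [h1, h2] with ω h1 h2 using lt_min h1 h2

namespace IsIIDClocks

variable {p : ℝ} (h : IsIIDClocks P X Y p)
include h

lemma measurable_pair (n : ℕ) : Measurable fun ω => (X n ω, Y n ω) :=
  (h.measurable_left n).prodMk (h.measurable_right n)

lemma measurableSet_lt (n : ℕ) : MeasurableSet {ω | X n ω < Y n ω} :=
  _root_.measurableSet_lt (h.measurable_left n) (h.measurable_right n)

lemma identDistrib_comp {g : ℝ × ℝ → ℝ} (hg : Measurable g) (n : ℕ) :
    IdentDistrib (fun ω => g (X n ω, Y n ω)) (fun ω => g (X 0 ω, Y 0 ω)) P P :=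
  IdentDistrib.comp ⟨(h.measurable_pair n).aemeasurable, (h.measurable_pair 0).aemeasurable,
    h.ident n⟩ hg

/-- The strong law of large numbers for a function of the pairs of clocks. -/
lemma strongLaw {g : ℝ × ℝ → ℝ} (hg : Measurable g)
    (hint : Integrable (fun ω => g (X 0 ω, Y 0 ω)) P) :
    ∀ᵐ ω ∂P, Tendsto (fun n : ℕ => (∑ k ∈ Finset.range n, g (X k ω, Y k ω)) / n) atTop
      (𝓝 (∫ ω, g (X 0 ω, Y 0 ω) ∂P)) := by
  refine strong_law_ae_real (fun n ω => g (X n ω, Y n ω)) hint (fun m n hmn => ?_)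
    fun n => h.identDistrib_comp hg n
  exact (h.indep.indepFun hmn).comp hg hg

lemma measurable_step (n : ℕ) : Measurable (step X Y n) :=
  Measurable.ite (h.measurableSet_lt n) measurable_const measurable_const

lemma integral_step [IsProbabilityMeasure P] (n : ℕ) : ∫ ω, (step X Y n ω : ℝ) ∂P = 2 * p - 1 := by
  have h1 : (fun ω => (step X Y n ω : ℝ))
      = fun ω => 2 * ({ω | X n ω < Y n ω}.indicator (fun _ => (1 : ℝ)) ω) - 1 := by
    funext ω
    by_cases hω : X n ω < Y n ω <;> simp [step, hω]
    norm_num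
  have h2 : Integrable ({ω | X n ω < Y n ω}.indicator fun _ => (1 : ℝ)) P :=
    (integrable_const 1).indicator (h.measurableSet_lt n)
  rw [h1, integral_sub (h2.const_mul 2) (integrable_const 1), integral_const_mul,
    integral_indicator_const _ (h.measurableSet_lt n), h.prob]
  simp

lemma tendsto_walk_div [IsProbabilityMeasure P] :
    ∀ᵐ ω ∂P, Tendsto (fun n : ℕ => (walk X Y n ω : ℝ) / n) atTop (𝓝 (2 * p - 1)) := by
  let g : ℝ × ℝ → ℝ := fun q => if q.1 < q.2 then 1 else -1
  have hg : Measurable g := Measurable.ite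
    (_root_.measurableSet_lt measurable_fst measurable_snd) measurable_const measurable_const
  have hgs : ∀ n ω, g (X n ω, Y n ω) = (step X Y n ω : ℝ) := fun n ω => by
    simp only [g, step]; split_ifs <;> simp
  have hint : Integrable (fun ω => g (X 0 ω, Y 0 ω)) P :=
    Integrable.of_bound (hg.comp (h.measurable_pair 0)).aestronglyMeasurable 1
      (ae_of_all _ fun ω => by simp only [g]; split_ifs <;> simp)
  have key := h.strongLaw hg hint
  simp only [hgs, h.integral_step] at key
  simpa [walk] using key

lemma tendsto_walk_atTop [IsProbabilityMeasure P] (hp : 1 / 2 < p) :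
    ∀ᵐ ω ∂P, Tendsto (fun n => walk X Y n ω) atTop atTop := by
  filter_upwards [h.tendsto_walk_div] with ω hω
  have h1 := (Tendsto.pos_mul_atTop (by linarith) hω tendsto_natCast_atTop_atTop)
  rw [← tendsto_intCast_atTop_iff (R := ℝ)]
  refine h1.congr' ?_
  filter_upwards [eventually_gt_atTop 0] with n hn
  have : (n : ℝ) ≠ 0 := by positivity
  simp [this]

lemma tendsto_walk_atBot [IsProbabilityMeasure P] (hp : p < 1 / 2) :
    ∀ᵐ ω ∂P, Tendsto (fun n => walk X Y n ω) atTop atBot := by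
  filter_upwards [h.tendsto_walk_div] with ω hω
  have h1 := (Tendsto.neg_mul_atTop (by linarith) hω tendsto_natCast_atTop_atTop)
  rw [← tendsto_intCast_atBot_iff (R := ℝ)]
  refine h1.congr' ?_
  filter_upwards [eventually_gt_atTop 0] with n hn
  have : (n : ℝ) ≠ 0 := by positivity
  simp [this]

lemma tendsto_eventTime [IsProbabilityMeasure P] :
    ∀ᵐ ω ∂P, Tendsto (fun n => eventTime X Y n ω) atTop atTop := by
  -- No integrability of the inter-event times is assumed, so the strong law is applied to their
  -- truncation at `1`, whose mean is finite and positive.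
  let g : ℝ × ℝ → ℝ := fun q => max 0 (min 1 (min q.1 q.2))
  have hg : Measurable g := by fun_prop
  have hint : Integrable (fun ω => g (X 0 ω, Y 0 ω)) P :=
    Integrable.of_bound (hg.comp (h.measurable_pair 0)).aestronglyMeasurable 1
      (ae_of_all _ fun ω => by simp [g, abs_of_nonneg])
  have hpos : 0 < ∫ ω, g (X 0 ω, Y 0 ω) ∂P := by
    have hnn : 0 ≤ fun ω => g (X 0 ω, Y 0 ω) := fun ω => le_max_left _ _
    rw [integral_pos_iff_support_of_nonneg hnn hint]
    have : Function.support (fun ω => g (X 0 ω, Y 0 ω)) =ᵐ[P] Set.univ := by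
      rw [eventuallyEq_univ]
      filter_upwards [h.pos 0] with ω hω
      exact (lt_max_of_lt_right (lt_min one_pos hω)).ne'
    rw [measure_congr this, measure_univ]
    exact one_pos
  filter_upwards [h.strongLaw hg hint, ae_all_iff.2 h.pos] with ω hω hω0
  refine tendsto_atTop_mono' _ ?_ (Tendsto.pos_mul_atTop hpos hω tendsto_natCast_atTop_atTop)
  filter_upwards [eventually_gt_atTop 0] with n hn
  have hn0 : (n : ℝ) ≠ 0 := by positivity
  rw [div_mul_cancel₀ _ hn0, eventTime]
  exact Finset.sum_le_sum fun k _ => max_le (hω0 k).le (min_le_right _ _)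

/-- Above the critical ratio the embedded queue is transient. -/
lemma isTransient [IsProbabilityMeasure P] (hp : 1 / 2 < p) :
    IsTransient P (embeddedQueue X Y) := by
  intro i
  have key : ∀ᵐ ω ∂P, ¬ ∃ᶠ n in atTop, embeddedQueue X Y i n ω = i := by
    filter_upwards [h.tendsto_walk_atTop hp] with ω hω
    rw [not_frequently]
    filter_upwards [hω.eventually_gt_atTop 0] with n hn heq
    have := add_walk_le_embeddedQueue X Y ω i n
    omega
  simpa only [ae_iff, not_not] using key

end IsIIDClocks

end

/-! ### Measurability and independence of the past. -/

section

variable {Ω : Type*}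

lemma measurable_embeddedQueue [MeasurableSpace Ω] {X Y : ℕ → Ω → ℝ} (i n : ℕ)
    (hX : ∀ k < n, Measurable (X k)) (hY : ∀ k < n, Measurable (Y k)) :
    Measurable (embeddedQueue X Y i n) := by
  induction n with
  | zero => exact measurable_const
  | succ n ih =>
    have ih := ih (fun k hk => hX k (by omega)) fun k hk => hY k (by omega)
    exact Measurable.ite (measurableSet_lt (hX n n.lt_succ_self) (hY n n.lt_succ_self))
      ((measurable_from_top (f := fun k : ℕ => k + 1)).comp ih)
      ((measurable_from_top (f := fun k : ℕ => k - 1)).comp ih)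

variable [MeasurableSpace Ω] {P : Measure Ω} {X Y : ℕ → Ω → ℝ}

lemma measurable_revQueue (hX : ∀ k, Measurable (X k)) (hY : ∀ k, Measurable (Y k)) (n i : ℕ) :
    Measurable (revQueue X Y n i) := by
  induction n generalizing i with
  | zero => exact measurable_const
  | succ n ih =>
    have : revQueue X Y (n + 1) i = fun ω =>
        if X n ω < Y n ω then revQueue X Y n (i + 1) ω else revQueue X Y n (i - 1) ω := by
      funext ω
      rw [revQueue]
      split_ifs <;> rfl
    rw [this]
    exact Measurable.ite (measurableSet_lt (hX n) (hY n)) (ih _) (ih _)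

lemma measurable_eventTime (hX : ∀ k, Measurable (X k)) (hY : ∀ k, Measurable (Y k)) (n : ℕ) :
    Measurable (eventTime X Y n) :=
  Finset.measurable_fun_sum _ fun k _ => (hX k).min (hY k)

/-- The events before the `n`-th one. -/
@[reducible] def past (X Y : ℕ → Ω → ℝ) (n : ℕ) : MeasurableSpace Ω :=
  ⨆ k ∈ Set.Iio n, MeasurableSpace.comap (fun ω => (X k ω, Y k ω)) inferInstance

omit [MeasurableSpace Ω] in
lemma measurable_pair_past {n k : ℕ} (hk : k < n) :
    Measurable[past X Y n] fun ω => (X k ω, Y k ω) :=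
  measurable_iff_comap_le.2 (le_biSup (f := fun k =>
    MeasurableSpace.comap (fun ω => (X k ω, Y k ω)) inferInstance) (Set.mem_Iio.2 hk))

omit [MeasurableSpace Ω] in
lemma measurable_left_past {n k : ℕ} (hk : k < n) : Measurable[past X Y n] (X k) :=
  measurable_fst.comp (measurable_pair_past hk)

omit [MeasurableSpace Ω] in
lemma measurable_right_past {n k : ℕ} (hk : k < n) : Measurable[past X Y n] (Y k) :=
  measurable_snd.comp (measurable_pair_past hk)

omit [MeasurableSpace Ω] in
lemma past_mono : Monotone (past X Y) := fun _ _ hmn =>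
  biSup_mono fun _ hk => lt_of_lt_of_le hk hmn

omit [MeasurableSpace Ω] in
lemma measurable_embeddedQueue_past (i n : ℕ) : Measurable[past X Y n] (embeddedQueue X Y i n) :=
  @measurable_embeddedQueue Ω (past X Y n) X Y i n (fun _ hk => measurable_left_past hk)
    fun _ hk => measurable_right_past hk

omit [MeasurableSpace Ω] in
lemma measurableSet_lt_comap (n : ℕ) : MeasurableSet[MeasurableSpace.comap
    (fun ω => (X n ω, Y n ω)) inferInstance] {ω | X n ω < Y n ω} :=
  ⟨{q : ℝ × ℝ | q.1 < q.2}, measurableSet_lt measurable_fst measurable_snd, rfl⟩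

namespace IsIIDClocks

variable {p : ℝ} (h : IsIIDClocks P X Y p)
include h

lemma past_le (n : ℕ) : past X Y n ≤ ‹MeasurableSpace Ω› :=
  iSup₂_le fun k _ => (h.measurable_pair k).comap_le

lemma indep_past (n : ℕ) : Indep (past X Y n)
    (MeasurableSpace.comap (fun ω => (X n ω, Y n ω)) inferInstance) P := by
  have h1 := indep_iSup_of_disjoint (fun k => (h.measurable_pair k).comap_le) h.indep.iIndep
    (S := Set.Iio n) (T := {n}) (by simp)
  rwa [iSup_singleton] at h1

lemma real_inter_lt {E : Set Ω} {n : ℕ} (hE : MeasurableSet[past X Y n] E) :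
    P.real (E ∩ {ω | X n ω < Y n ω}) = P.real E * p := by
  rw [measureReal_def, (Indep_iff _ _ _).1 (h.indep_past n) _ _ hE (measurableSet_lt_comap n),
    ENNReal.toReal_mul, ← measureReal_def, ← measureReal_def, h.prob]

lemma real_sdiff_lt [IsProbabilityMeasure P] {E : Set Ω} {n : ℕ}
    (hE : MeasurableSet[past X Y n] E) :
    P.real (E \ {ω | X n ω < Y n ω}) = P.real E * (1 - p) := by
  have h1 := measureReal_sdiff_add_inter (μ := P) (s := E) (h.measurableSet_lt n)
  rw [h.real_inter_lt hE] at h1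
  linarith

lemma real_embeddedQueue_succ [IsProbabilityMeasure P] (i n j : ℕ) :
    P.real {ω | embeddedQueue X Y i (n + 1) ω = j} =
      P.real {ω | embeddedQueue X Y i n ω + 1 = j} * p +
        P.real {ω | embeddedQueue X Y i n ω - 1 = j} * (1 - p) := by
  have hm : ∀ s : Set ℕ, MeasurableSet[past X Y n] {ω | embeddedQueue X Y i n ω ∈ s} := fun s =>
    measurable_embeddedQueue_past i n s.to_countable.measurableSet
  have h1 := hm {k | k + 1 = j}
  have h2 := hm {k | k - 1 = j}
  simp only [Set.mem_ofPred_eq] at h1 h2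
  rw [← h.real_inter_lt h1, ← h.real_sdiff_lt h2, ← measureReal_union]
  · congr 1
    ext ω
    by_cases hω : X n ω < Y n ω <;> simp [embeddedQueue, hω]
  · exact Set.disjoint_left.2 fun ω hω hω' => hω'.2 hω.2
  · exact MeasurableSet.diff (h.past_le n _ h2) (h.measurableSet_lt n)

end IsIIDClocks

end

/-! ### Time reversal and convergence in law. -/

section

variable {Ω : Type*}

/-- The permutation of `ℕ` that reverses the order of the first `m` numbers. -/
def reversal (m k : ℕ) : ℕ := if k < m then m - 1 - k else k

lemma reversal_injective (m : ℕ) : Function.Injective (reversal m) := by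
  intro k l hkl
  simp only [reversal] at hkl
  split_ifs at hkl <;> omega

lemma eventTime_succ (X Y : ℕ → Ω → ℝ) (n : ℕ) (ω : Ω) :
    eventTime X Y (n + 1) ω = eventTime X Y n ω + min (X n ω) (Y n ω) :=
  Finset.sum_range_succ _ _

lemma eventTime_reversal (X Y : ℕ → Ω → ℝ) (m : ℕ) (ω : Ω) :
    eventTime (fun k => X (reversal m k)) (fun k => Y (reversal m k)) m ω = eventTime X Y m ω := by
  rw [eventTime, eventTime, ← Finset.sum_range_reflect]
  refine Finset.sum_congr rfl fun k hk => ?_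
  have hk := Finset.mem_range.1 hk
  have h1 : reversal m (m - 1 - k) = k := by
    rw [reversal, if_pos (by omega)]; omega
  rw [h1]

lemma eventTime_reversal_succ (X Y : ℕ → Ω → ℝ) (m : ℕ) (ω : Ω) :
    eventTime (fun k => X (reversal m k)) (fun k => Y (reversal m k)) (m + 1) ω
      = eventTime X Y (m + 1) ω := by
  have h1 : reversal m m = m := if_neg (lt_irrefl m)
  rw [eventTime_succ, eventTime_succ, eventTime_reversal, h1]

lemma embeddedQueue_eq_coordinates (X Y : ℕ → Ω → ℝ) (i n : ℕ) (ω : Ω) :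
    embeddedQueue X Y i n ω = embeddedQueue (fun k (z : ℕ → ℝ × ℝ) => (z k).1)
      (fun k (z : ℕ → ℝ × ℝ) => (z k).2) i n fun k => (X k ω, Y k ω) := by
  induction n with
  | zero => rfl
  | succ n ih => rw [embeddedQueue, embeddedQueue, ih]

/-- Strict monotonicity turns the set of admissible `n` into `Set.Iic m`, so `sSup` is a genuine
maximum and not the default value for an unbounded set. -/
lemma eventCount_eq {X Y : ℕ → Ω → ℝ} {ω : Ω} (hS : StrictMono fun n => eventTime X Y n ω) {t : ℝ}
    {m : ℕ} (h1 : eventTime X Y m ω ≤ t) (h2 : t < eventTime X Y (m + 1) ω) :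
    eventCount X Y t ω = m := by
  have : {n : ℕ | eventTime X Y n ω ≤ t} = Set.Iic m := by
    ext n
    constructor
    · intro hn
      exact Nat.lt_succ_iff.1 (hS.lt_iff_lt.1 (lt_of_le_of_lt hn h2))
    · intro hn
      exact (hS.monotone hn).trans h1
  rw [eventCount, this, csSup_Iic]

lemma exists_eventTime_le_lt {X Y : ℕ → Ω → ℝ} {ω : Ω}
    (hS : Tendsto (fun n => eventTime X Y n ω) atTop atTop) {t : ℝ} (ht : 0 ≤ t) :
    ∃ m, eventTime X Y m ω ≤ t ∧ t < eventTime X Y (m + 1) ω := by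
  have hex : ∃ n, t < eventTime X Y n ω := (hS.eventually_gt_atTop t).exists
  classical
  have h0 : Nat.find hex ≠ 0 := fun h => by
    have := Nat.find_spec hex
    rw [h, eventTime, Finset.range_zero, Finset.sum_empty] at this
    exact absurd this (not_lt.2 ht)
  obtain ⟨m, hm⟩ := Nat.exists_eq_succ_of_ne_zero h0
  refine ⟨m, not_lt.1 (Nat.find_min hex (by omega)), ?_⟩
  rw [← Nat.succ_eq_add_one, ← hm]
  exact Nat.find_spec hex

variable [MeasurableSpace Ω] {P : Measure Ω} {X Y : ℕ → Ω → ℝ}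

namespace IsIIDClocks

variable {p : ℝ} (h : IsIIDClocks P X Y p)
include h

/-- The law of an i.i.d. sequence does not depend on the order of its members. -/
lemma map_comp_injective {σ : ℕ → ℕ} (hσ : Function.Injective σ) :
    P.map (fun ω k => (X (σ k) ω, Y (σ k) ω)) = P.map (fun ω k => (X k ω, Y k ω)) := by
  rw [(h.indep.precomp hσ).map_fun_eq_infinitePi_map fun k => h.measurable_pair (σ k),
    h.indep.map_fun_eq_infinitePi_map h.measurable_pair]
  congr 1
  funext k
  exact (h.ident (σ k)).trans (h.ident k).symm

/-- Given the times of the events, the queue and the reversed queue have the same law. -/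
lemma measure_embeddedQueue_eq_revQueue (i m j : ℕ) {B : Set (ℝ × ℝ)} (hB : MeasurableSet B) :
    P {ω | embeddedQueue X Y i m ω = j ∧ (eventTime X Y m ω, eventTime X Y (m + 1) ω) ∈ B} =
      P {ω | revQueue X Y m i ω = j ∧ (eventTime X Y m ω, eventTime X Y (m + 1) ω) ∈ B} := by
  let U : ℕ → (ℕ → ℝ × ℝ) → ℝ := fun k z => (z k).1
  let V : ℕ → (ℕ → ℝ × ℝ) → ℝ := fun k z => (z k).2
  have hU : ∀ k, Measurable (U k) := fun k => measurable_fst.comp (measurable_pi_apply k)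
  have hV : ∀ k, Measurable (V k) := fun k => measurable_snd.comp (measurable_pi_apply k)
  let C : Set (ℕ → ℝ × ℝ) :=
    {z | embeddedQueue U V i m z = j ∧ (eventTime U V m z, eventTime U V (m + 1) z) ∈ B}
  have hC : MeasurableSet C :=
    (measurable_embeddedQueue i m (fun k _ => hU k) (fun k _ => hV k) (measurableSet_singleton j)).inter
      ((measurable_eventTime hU hV m).prodMk (measurable_eventTime hU hV (m + 1)) hB)
  have h1 : {ω | embeddedQueue X Y i m ω = j ∧ (eventTime X Y m ω, eventTime X Y (m + 1) ω) ∈ B}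
      = (fun ω k => (X k ω, Y k ω)) ⁻¹' C := by
    ext ω
    simp only [Set.mem_preimage, C, Set.mem_ofPred_eq]
    rw [embeddedQueue_eq_coordinates]
    rfl
  have h2 : {ω | revQueue X Y m i ω = j ∧ (eventTime X Y m ω, eventTime X Y (m + 1) ω) ∈ B}
      = (fun ω k => (X (reversal m k) ω, Y (reversal m k) ω)) ⁻¹' C := by
    ext ω
    simp only [Set.mem_preimage, C, Set.mem_ofPred_eq]
    rw [← eventTime_reversal, ← eventTime_reversal_succ, ← embeddedQueue_eq_revQueue X Y ω
      (X' := fun k => X (reversal m k)) (Y' := fun k => Y (reversal m k)) m i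
      (fun k hk => by rw [reversal, if_pos hk]) (fun k hk => by rw [reversal, if_pos hk]),
      embeddedQueue_eq_coordinates]
    rfl
  rw [h1, h2, ← Measure.map_apply (measurable_pi_iff.2 h.measurable_pair) hC,
    ← Measure.map_apply (measurable_pi_iff.2 fun k => h.measurable_pair _) hC,
    h.map_comp_injective (reversal_injective m)]

lemma ae_strictMono_eventTime : ∀ᵐ ω ∂P, StrictMono fun n => eventTime X Y n ω := by
  filter_upwards [ae_all_iff.2 h.pos] with ω hω
  refine strictMono_nat_of_lt_succ fun n => ?_
  rw [eventTime_succ]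
  exact lt_add_of_pos_right _ (hω n)

/-- Almost surely at most one `m` satisfies `S_m ≤ t < S_(m+1)`, so the union over `m` is disjoint
up to null sets. This lets the fixed-`m` reversal identity be summed over the random number of
events. -/
lemma measure_exists_eventTime {q : ℕ → Ω → ℕ} (hq : ∀ m, Measurable (q m)) (j : ℕ) (t : ℝ) :
    P {ω | ∃ m, q m ω = j ∧ (eventTime X Y m ω, eventTime X Y (m + 1) ω) ∈ Set.Iic t ×ˢ Set.Ioi t}
      = ∑' m, P {ω | q m ω = j ∧
        (eventTime X Y m ω, eventTime X Y (m + 1) ω) ∈ Set.Iic t ×ˢ Set.Ioi t} := by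
  rw [Set.ofPred_exists, measure_iUnion₀]
  · intro m n hmn
    have hsub : ∀ᵐ ω ∂P, ω ∉ {ω | q m ω = j ∧
        (eventTime X Y m ω, eventTime X Y (m + 1) ω) ∈ Set.Iic t ×ˢ Set.Ioi t} ∩
        {ω | q n ω = j ∧
        (eventTime X Y n ω, eventTime X Y (n + 1) ω) ∈ Set.Iic t ×ˢ Set.Ioi t} := by
      filter_upwards [h.ae_strictMono_eventTime] with ω hω hmem
      exact hmn ((eventCount_eq hω hmem.1.2.1 hmem.1.2.2).symm.trans
        (eventCount_eq hω hmem.2.2.1 hmem.2.2.2))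
    exact measure_eq_zero_iff_ae_notMem.2 hsub
  · intro m
    exact ((hq m (measurableSet_singleton j)).inter
      ((measurable_eventTime h.measurable_left h.measurable_right m).prodMk
        (measurable_eventTime h.measurable_left h.measurable_right (m + 1))
        (measurableSet_Iic.prod measurableSet_Ioi))).nullMeasurableSet

/-- The law of the queue length at time `t` in terms of the reversed queue. -/
lemma measure_queueLength_eq [IsProbabilityMeasure P] (i j : ℕ) {t : ℝ} (ht : 0 ≤ t) :
    P {ω | queueLength X Y i t ω = j} = P {ω | ∃ m, revQueue X Y m i ω = j ∧
      (eventTime X Y m ω, eventTime X Y (m + 1) ω) ∈ Set.Iic t ×ˢ Set.Ioi t} := by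
  rw [h.measure_exists_eventTime (measurable_revQueue h.measurable_left h.measurable_right · i)]
  simp_rw [← h.measure_embeddedQueue_eq_revQueue i _ j (measurableSet_Iic.prod measurableSet_Ioi)]
  rw [← h.measure_exists_eventTime (fun m => measurable_embeddedQueue i m
    (fun k _ => h.measurable_left k) fun k _ => h.measurable_right k)]
  refine measure_congr ?_
  filter_upwards [h.ae_strictMono_eventTime, h.tendsto_eventTime] with ω hmono htend
  obtain ⟨m, hm1, hm2⟩ := exists_eventTime_le_lt htend ht
  refine propext ⟨fun hω => ⟨m, ?_, hm1, hm2⟩, fun ⟨n, hn, hn1, hn2⟩ => ?_⟩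
  · rw [← eventCount_eq hmono hm1 hm2]
    exact hω
  · rw [← eventCount_eq hmono hn1 hn2] at hn
    exact hn

/-- Below the critical ratio the reversed queue is eventually constant. -/
lemma exists_limit_revQueue [IsProbabilityMeasure P] (hp : p < 1 / 2) :
    ∃ M : Ω → ℕ, Measurable M ∧
      ∀ᵐ ω ∂P, ∀ i, ∀ᶠ n in atTop, revQueue X Y n i ω = M ω := by
  have hlim : ∀ᵐ ω ∂P, ∃ c : ℕ, ∀ i, ∀ᶠ n in atTop, revQueue X Y n i ω = c := by
    filter_upwards [h.tendsto_walk_atBot hp] with ω hω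
    exact exists_eventually_revQueue_eq X Y ω hω
  -- The limit is chosen measurably from the paths with `i = 0`; the pathwise constant then serves
  -- every `i`.
  obtain ⟨M, hM, hMlim⟩ := measurable_limit_of_tendsto_metrizable_ae (L := atTop)
    (fun n => (measurable_revQueue h.measurable_left h.measurable_right n 0).aemeasurable) (by
      filter_upwards [hlim] with ω ⟨c, hc⟩
      exact ⟨c, by rw [nhds_discrete]; exact tendsto_pure.2 (hc 0)⟩)
  refine ⟨M, hM, ?_⟩
  filter_upwards [hlim, hMlim] with ω ⟨c, hc⟩ hω i
  rw [nhds_discrete, tendsto_pure] at hω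
  obtain ⟨n, hn1, hn2⟩ := (hω.and (hc 0)).exists
  rw [← hn1, hn2]
  exact hc i

lemma tendsto_measure_embeddedQueue [IsProbabilityMeasure P] {M : Ω → ℕ} (hM : Measurable M)
    (hlim : ∀ᵐ ω ∂P, ∀ i, ∀ᶠ n in atTop, revQueue X Y n i ω = M ω) (i j : ℕ) :
    Tendsto (fun n => P {ω | embeddedQueue X Y i n ω = j}) atTop (𝓝 (P {ω | M ω = j})) := by
  have heq : ∀ n, P {ω | embeddedQueue X Y i n ω = j} = P {ω | revQueue X Y n i ω = j} := by
    intro n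
    simpa using h.measure_embeddedQueue_eq_revQueue i n j MeasurableSet.univ
  simp_rw [heq]
  refine tendsto_measure_of_ae_tendsto_indicator_of_isFiniteMeasure atTop
    (hM (measurableSet_singleton j)) (fun n =>
      measurable_revQueue h.measurable_left h.measurable_right n i (measurableSet_singleton j)) ?_
  filter_upwards [hlim] with ω hω
  filter_upwards [hω i] with n hn
  exact ⟨fun hr => hn.symm.trans hr, fun hr => hn.trans hr⟩

lemma tendsto_measure_queueLength [IsProbabilityMeasure P] {M : Ω → ℕ} (hM : Measurable M)
    (hlim : ∀ᵐ ω ∂P, ∀ i, ∀ᶠ n in atTop, revQueue X Y n i ω = M ω) (i j : ℕ) :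
    Tendsto (fun t : ℝ => P {ω | queueLength X Y i t ω = j}) atTop (𝓝 (P {ω | M ω = j})) := by
  have hmeas : ∀ t : ℝ, MeasurableSet {ω | ∃ m, revQueue X Y m i ω = j ∧
      (eventTime X Y m ω, eventTime X Y (m + 1) ω) ∈ Set.Iic t ×ˢ Set.Ioi t} := by
    intro t
    rw [Set.ofPred_exists]
    exact MeasurableSet.iUnion fun m =>
      (measurable_revQueue h.measurable_left h.measurable_right m i
        (measurableSet_singleton j)).inter
      ((measurable_eventTime h.measurable_left h.measurable_right m).prodMk
        (measurable_eventTime h.measurable_left h.measurable_right (m + 1))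
        (measurableSet_Iic.prod measurableSet_Ioi))
  have key := tendsto_measure_of_ae_tendsto_indicator_of_isFiniteMeasure (μ := P) atTop
    (hM (measurableSet_singleton j)) hmeas (by
      filter_upwards [hlim, h.ae_strictMono_eventTime, h.tendsto_eventTime] with ω hω hmono htend
      -- Once `t` is beyond the `N`-th event time, at least `N` events have occurred and the
      -- reversed queue already has its final value.
      obtain ⟨N, hN⟩ := eventually_atTop.1 (hω i)
      filter_upwards [eventually_ge_atTop 0, eventually_ge_atTop (eventTime X Y N ω)] with t ht htN
      have hge : ∀ m, t < eventTime X Y (m + 1) ω → N ≤ m := fun m hm =>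
        Nat.lt_succ_iff.1 (hmono.lt_iff_lt.1 (htN.trans_lt hm))
      constructor
      · rintro ⟨m, hm, hm1, hm2⟩
        exact (hN m (hge m hm2)).symm.trans hm
      · intro hMj
        obtain ⟨m, hm1, hm2⟩ := exists_eventTime_le_lt htend ht
        exact ⟨m, (hN m (hge m hm2)).trans hMj, hm1, hm2⟩)
  refine key.congr' ?_
  filter_upwards [eventually_ge_atTop 0] with t ht
  exact (h.measure_queueLength_eq i j ht).symm

end IsIIDClocks

end

/-! ### Balance equations and the invariant distribution. -/

section

/-- The global balance equations of the embedded queue. -/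
def IsBalanced (p : ℝ) (q : ℕ → ℝ) : Prop :=
  q 0 = (1 - p) * (q 0 + q 1) ∧ ∀ j, q (j + 1) = p * q j + (1 - p) * q (j + 2)

lemma IsBalanced.eq_mul_pow {p : ℝ} (hp : p < 1) {q : ℕ → ℝ} (hq : IsBalanced p q) (j : ℕ) :
    q j = q 0 * (p / (1 - p)) ^ j := by
  have h : 1 - p ≠ 0 := by linarith
  -- Global balance telescopes to detailed balance across each edge, starting from the boundary
  -- equation at `0`.
  have hstep : ∀ j, (1 - p) * q (j + 1) = p * q j := by
    intro j
    induction j with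
    | zero => linarith [hq.1]
    | succ j ih => linarith [hq.2 j]
  induction j with
  | zero => simp
  | succ j ih =>
    rw [pow_succ, ← mul_assoc, ← ih]
    field_simp
    linarith [hstep j]

lemma IsBalanced.eq_equilibriumWeight {p : ℝ} (hp0 : 0 ≤ p) (hp : p < 1 / 2) {q : ℕ → ℝ}
    (hq : IsBalanced p q) (hsum : HasSum q 1) (j : ℕ) : q j = equilibriumWeight p j := by
  have h : 0 < 1 - p := by linarith
  have hr : p / (1 - p) < 1 := by rw [div_lt_one h]; linarith
  have h1 := (hasSum_geometric_of_lt_one (by positivity) hr).mul_left (q 0)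
  rw [← funext (hq.eq_mul_pow (by linarith))] at h1
  have h2 := h1.unique hsum
  rw [hq.eq_mul_pow (by linarith), equilibriumWeight]
  congr 1
  have h3 : 1 - p / (1 - p) ≠ 0 := by linarith
  rw [← div_eq_mul_inv, div_eq_one_iff_eq h3] at h2
  rw [h2]
  field_simp
  ring

lemma hasSum_toReal_pmf (ν : PMF ℕ) : HasSum (fun j => (ν j).toReal) 1 := by
  have h := ENNReal.hasSum_toReal (f := ν) (by rw [ν.tsum_coe]; exact ENNReal.one_ne_top)
  rwa [← ENNReal.tsum_toReal_eq ν.apply_ne_top, ν.tsum_coe, ENNReal.toReal_one] at h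

variable {Ω : Type*} [MeasurableSpace Ω] {P : Measure Ω} {X Y : ℕ → Ω → ℝ}

namespace IsIIDClocks

variable {p : ℝ} (h : IsIIDClocks P X Y p)
include h

lemma real_embeddedQueue_one [IsProbabilityMeasure P] (i j : ℕ) :
    P.real {ω | embeddedQueue X Y i 1 ω = j} =
      (if i + 1 = j then p else 0) + if i - 1 = j then 1 - p else 0 := by
  rw [h.real_embeddedQueue_succ]
  simp only [embeddedQueue]
  congr 1 <;> split_ifs with hij <;> simp [hij]

lemma isInvariant_iff [IsProbabilityMeasure P] (ν : PMF ℕ) :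
    IsInvariant P (embeddedQueue X Y) ν ↔ IsBalanced p fun j => (ν j).toReal := by
  have hne : ∀ i j, ν i * P {ω | embeddedQueue X Y i 1 ω = j} ≠ ∞ := fun i j =>
    ENNReal.mul_ne_top (ν.apply_ne_top i) (measure_ne_top _ _)
  have hle : ∀ j, ∑' i, ν i * P {ω | embeddedQueue X Y i 1 ω = j} ≠ ∞ := fun j =>
    ne_top_of_le_ne_top (ν.tsum_coe ▸ ENNReal.one_ne_top)
      (ENNReal.tsum_le_tsum fun i => mul_le_of_le_one_right' prob_le_one)
  have hreal : ∀ j, (∑' i, ν i * P {ω | embeddedQueue X Y i 1 ω = j} = ν j) ↔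
      ∑' i, (ν i).toReal * ((if i + 1 = j then p else 0) + if i - 1 = j then 1 - p else 0)
        = (ν j).toReal := by
    intro j
    rw [← ENNReal.toReal_eq_toReal_iff' (hle j) (ν.apply_ne_top j),
      ENNReal.tsum_toReal_eq fun i => hne i j]
    simp_rw [ENNReal.toReal_mul, ← measureReal_def, h.real_embeddedQueue_one]
  have h0 : ∑' i, (ν i).toReal * ((if i + 1 = 0 then p else 0) + if i - 1 = 0 then 1 - p else 0)
      = (1 - p) * ((ν 0).toReal + (ν 1).toReal) := by
    rw [tsum_eq_sum (s := {0, 1}) fun i hi => by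
      simp only [Finset.mem_insert, Finset.mem_singleton, not_or] at hi
      rw [if_neg (by omega), if_neg (by omega), add_zero, mul_zero]]
    rw [Finset.sum_pair zero_ne_one]
    simp
    ring
  have h1 : ∀ j, ∑' i, (ν i).toReal *
      ((if i + 1 = j + 1 then p else 0) + if i - 1 = j + 1 then 1 - p else 0)
      = p * (ν j).toReal + (1 - p) * (ν (j + 2)).toReal := by
    intro j
    rw [tsum_eq_sum (s := {j, j + 2}) fun i hi => by
      simp only [Finset.mem_insert, Finset.mem_singleton, not_or] at hi
      rw [if_neg (by omega), if_neg (by omega), add_zero, mul_zero]]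
    rw [Finset.sum_pair (by omega), if_pos rfl, if_neg (by omega), if_neg (by omega),
      if_pos (by omega)]
    ring
  rw [IsInvariant]
  simp_rw [hreal]
  constructor
  · intro hinv
    exact ⟨(hinv 0).symm.trans h0, fun j => (hinv (j + 1)).symm.trans (h1 j)⟩
  · rintro ⟨hb0, hb1⟩ j
    cases j with
    | zero => exact h0.trans hb0.symm
    | succ j => exact (h1 j).trans (hb1 j).symm

/-- Pass to the limit in the one-step recursion for the law of the queue; only two predecessor
states contribute, so no interchange of limit and sum is needed. -/
lemma isBalanced_of_tendsto [IsProbabilityMeasure P] {q : ℕ → ℝ} {i : ℕ}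
    (hq : ∀ j, Tendsto (fun n => P.real {ω | embeddedQueue X Y i n ω = j}) atTop (𝓝 (q j))) :
    IsBalanced p q := by
  have hm : ∀ n, Measurable (embeddedQueue X Y i n) := fun n => measurable_embeddedQueue i n
    (fun k _ => h.measurable_left k) fun k _ => h.measurable_right k
  refine ⟨tendsto_nhds_unique ((hq 0).comp (tendsto_add_atTop_nat 1)) ?_, fun j =>
    tendsto_nhds_unique ((hq (j + 1)).comp (tendsto_add_atTop_nat 1)) ?_⟩
  · refine (((hq 0).add (hq 1)).const_mul (1 - p)).congr fun n => ?_
    rw [Function.comp_apply, h.real_embeddedQueue_succ, ← measureReal_union]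
    · have h1 : {ω | embeddedQueue X Y i n ω + 1 = 0} = ∅ := by ext; simp
      have h2 : {ω | embeddedQueue X Y i n ω - 1 = 0} =
          {ω | embeddedQueue X Y i n ω = 0} ∪ {ω | embeddedQueue X Y i n ω = 1} := by
        ext ω
        simp only [Set.mem_ofPred_eq, Set.mem_union]
        omega
      rw [h1, h2, measureReal_empty]
      ring
    · exact Set.disjoint_left.2 fun ω h0 h1 => by
        simp only [Set.mem_ofPred_eq] at h0 h1
        omega
    · exact hm n (measurableSet_singleton 1)
  · refine (((hq j).const_mul p).add ((hq (j + 2)).const_mul (1 - p))).congr fun n => ?_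
    rw [Function.comp_apply, h.real_embeddedQueue_succ]
    have h1 : {ω | embeddedQueue X Y i n ω + 1 = j + 1} = {ω | embeddedQueue X Y i n ω = j} := by
      ext ω; simp
    have h2 : {ω | embeddedQueue X Y i n ω - 1 = j + 1} =
        {ω | embeddedQueue X Y i n ω = j + 2} := by
      ext ω
      simp only [Set.mem_ofPred_eq]
      omega
    rw [h1, h2]
    ring

/-- Below the critical ratio, the queue converges to its unique invariant distribution. -/
lemma exists_equilibrium [IsProbabilityMeasure P] (hp0 : 0 < p) (hp : p < 1 / 2) :
    ∃ π : PMF ℕ, (∀ j, (π j).toReal = equilibriumWeight p j) ∧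
      (∀ ν : PMF ℕ, IsInvariant P (embeddedQueue X Y) ν ↔ ν = π) ∧
      (∀ i j, Tendsto (fun n : ℕ => P.real {ω | embeddedQueue X Y i n ω = j})
        atTop (𝓝 (π j).toReal)) ∧
      (∀ i j, Tendsto (fun t : ℝ => P.real {ω | queueLength X Y i t ω = j})
        atTop (𝓝 (π j).toReal)) := by
  obtain ⟨M, hM, hlim⟩ := h.exists_limit_revQueue hp
  have := Measure.isProbabilityMeasure_map (μ := P) hM.aemeasurable
  let π : PMF ℕ := (P.map M).toPMF
  have hπ : ∀ j, π j = P {ω | M ω = j} := fun j => by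
    rw [Measure.toPMF_apply, Measure.map_apply hM (measurableSet_singleton j)]
    rfl
  have hQ : ∀ i j, Tendsto (fun n : ℕ => P.real {ω | embeddedQueue X Y i n ω = j})
      atTop (𝓝 (π j).toReal) := fun i j => by
    rw [hπ]
    exact (ENNReal.tendsto_toReal (measure_ne_top _ _)).comp
      (h.tendsto_measure_embeddedQueue hM hlim i j)
  have hL : ∀ i j, Tendsto (fun t : ℝ => P.real {ω | queueLength X Y i t ω = j})
      atTop (𝓝 (π j).toReal) := fun i j => by
    rw [hπ]
    exact (ENNReal.tendsto_toReal (measure_ne_top _ _)).comp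
      (h.tendsto_measure_queueLength hM hlim i j)
  have hw : ∀ j, (π j).toReal = equilibriumWeight p j :=
    (h.isBalanced_of_tendsto (hQ 0)).eq_equilibriumWeight hp0.le hp (hasSum_toReal_pmf π)
  refine ⟨π, hw, fun ν => ?_, hQ, hL⟩
  rw [h.isInvariant_iff]
  constructor
  · intro hν
    ext j
    rw [← ENNReal.toReal_eq_toReal_iff' (ν.apply_ne_top j) (π.apply_ne_top j), hw]
    exact hν.eq_equilibriumWeight hp0.le hp (hasSum_toReal_pmf ν) j
  · rintro rfl
    exact h.isBalanced_of_tendsto (hQ 0)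

/-- Below the critical ratio the embedded queue is not transient. -/
lemma not_isTransient_of_lt [IsProbabilityMeasure P] (hp0 : 0 < p) (hp : p < 1 / 2) :
    ¬ IsTransient P (embeddedQueue X Y) := by
  intro htr
  obtain ⟨π, hw, -, hQ, -⟩ := h.exists_equilibrium hp0 hp
  -- Transience would make the probability of being at `0` vanish in the limit, whereas that limit
  -- is the positive weight of `0`.
  have h1 : Tendsto (fun n => P {ω | embeddedQueue X Y 0 n ω = 0}) atTop (𝓝 (P ∅)) := by
    refine tendsto_measure_of_ae_tendsto_indicator_of_isFiniteMeasure atTop MeasurableSet.empty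
      (fun n => measurable_embeddedQueue 0 n (fun k _ => h.measurable_left k)
        (fun k _ => h.measurable_right k) (measurableSet_singleton 0)) ?_
    filter_upwards [measure_eq_zero_iff_ae_notMem.1 (htr 0)] with ω hω
    filter_upwards [not_frequently.1 hω] with n hn
    exact iff_of_false hn (Set.notMem_empty ω)
  have h2 := tendsto_nhds_unique (hQ 0 0)
    ((ENNReal.tendsto_toReal (measure_ne_top _ _)).comp h1)
  rw [hw, measure_empty, ENNReal.toReal_zero, equilibriumWeight, pow_zero, mul_one,
    div_eq_zero_iff] at h2
  rcases h2 with h2 | h2 <;> linarith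

end IsIIDClocks

end

/-! ### The critical case: martingales and null recurrence. -/

section

variable {Ω : Type*}

/-- The height above the initial state of the first excursion of the queue, if the first event is
an arrival, and `0` otherwise: `excursion X Y n` is the height after `n + 1` events, and the
excursion is stopped when it returns to `0`. -/
noncomputable def excursion (X Y : ℕ → Ω → ℝ) : ℕ → Ω → ℤ
  | 0, ω => if X 0 ω < Y 0 ω then 1 else 0
  | n + 1, ω => excursion X Y n ω + if 0 < excursion X Y n ω then step X Y (n + 1) ω else 0

lemma excursion_nonneg (X Y : ℕ → Ω → ℝ) (n : ℕ) (ω : Ω) : 0 ≤ excursion X Y n ω := by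
  induction n with
  | zero => rw [excursion]; split_ifs <;> simp
  | succ n ih =>
    have := step_eq_or X Y ω (n + 1)
    rw [excursion]
    split_ifs <;> omega

lemma excursion_le (X Y : ℕ → Ω → ℝ) (n : ℕ) (ω : Ω) : excursion X Y n ω ≤ n + 1 := by
  induction n with
  | zero => rw [excursion]; split_ifs <;> simp
  | succ n ih =>
    have := step_eq_or X Y ω (n + 1)
    rw [excursion]
    split_ifs <;> push_cast <;> omega

lemma excursion_eq_zero_of_le (X Y : ℕ → Ω → ℝ) (ω : Ω) {m n : ℕ} (hmn : m ≤ n)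
    (h : excursion X Y m ω = 0) : excursion X Y n ω = 0 := by
  induction n, hmn using Nat.le_induction with
  | base => exact h
  | succ n _ ih => rw [excursion, ih]; simp

/-- During the excursion the queue stays strictly above `i`, so the truncation at `0` never acts. -/
lemma embeddedQueue_eq_add_excursion (X Y : ℕ → Ω → ℝ) (i n : ℕ) (ω : Ω)
    (h : 0 < excursion X Y n ω) :
    (embeddedQueue X Y i (n + 1) ω : ℤ) = i + excursion X Y n ω := by
  induction n with
  | zero =>
    rw [excursion] at h ⊢
    split_ifs at h ⊢ with h0
    · simp [embeddedQueue, h0]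
    · exact absurd h (lt_irrefl 0)
  | succ n ih =>
    have h0 : 0 < excursion X Y n ω := by
      refine lt_of_le_of_ne (excursion_nonneg X Y n ω) fun h0 => ?_
      rw [excursion_eq_zero_of_le X Y ω n.le_succ h0.symm] at h
      exact absurd h (lt_irrefl 0)
    rw [embeddedQueue_succ_cast, ih h0, excursion, if_pos h0]
    rw [excursion, if_pos h0] at h
    omega

lemma excursion_eq_zero_of_return (X Y : ℕ → Ω → ℝ) (ω : Ω) {i m n : ℕ} (hm : 1 ≤ m)
    (hmn : m ≤ n + 1) (h : embeddedQueue X Y i m ω = i) : excursion X Y n ω = 0 := by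
  refine excursion_eq_zero_of_le X Y ω (m := m - 1) (by omega) ?_
  by_contra hne
  have h1 := embeddedQueue_eq_add_excursion X Y i (m - 1) ω
    (lt_of_le_of_ne (excursion_nonneg X Y _ ω) (Ne.symm hne))
  rw [Nat.sub_add_cancel hm, h] at h1
  omega

/-- If the chain has returned by time `n + 1` the excursion is over and the left side is `0`;
otherwise the return time exceeds `n + 1`, which bounds the height. -/
lemma ofReal_excursion_le_returnTime (X Y : ℕ → Ω → ℝ) (i n : ℕ) (ω : Ω) :
    ENNReal.ofReal (excursion X Y n ω) ≤ returnTime (embeddedQueue X Y) i ω := by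
  refine le_iInf₂ fun m hm => ?_
  rcases le_or_gt m (n + 1) with hmn | hmn
  · simp [excursion_eq_zero_of_return X Y ω hm.1 hmn hm.2]
  · rw [← ENNReal.ofReal_natCast]
    refine ENNReal.ofReal_le_ofReal ?_
    have := excursion_le X Y n ω
    exact_mod_cast this.trans (by omega : (n : ℤ) + 1 ≤ m)

lemma measurable_excursion_past (X Y : ℕ → Ω → ℝ) (n : ℕ) :
    Measurable[past X Y (n + 1)] (excursion X Y n) := by
  have hlt : ∀ n, MeasurableSet[past X Y (n + 1)] {ω | X n ω < Y n ω} := fun n =>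
    measurable_pair_past n.lt_succ_self (measurableSet_lt measurable_fst measurable_snd)
  induction n with
  | zero => exact Measurable.ite (hlt 0) measurable_const measurable_const
  | succ n ih =>
    have ih' : Measurable[past X Y (n + 1 + 1)] (excursion X Y n) :=
      ih.mono (past_mono (n + 1).le_succ) le_rfl
    exact ih'.add (Measurable.ite (ih' measurableSet_Ioi)
      (Measurable.ite (hlt (n + 1)) measurable_const measurable_const) measurable_const)

variable [MeasurableSpace Ω] {P : Measure Ω} {X Y : ℕ → Ω → ℝ}

namespace IsIIDClocks

variable {p : ℝ} (h : IsIIDClocks P X Y p)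
include h

lemma integrable_step [IsProbabilityMeasure P] (n : ℕ) :
    Integrable (fun ω => (step X Y n ω : ℝ)) P := by
  refine Integrable.of_bound
    ((measurable_from_top (f := fun k : ℤ => (k : ℝ))).comp
      (h.measurable_step n)).aestronglyMeasurable 1 (ae_of_all _ fun ω => ?_)
  rcases step_eq_or X Y ω n with h1 | h1 <;> simp [h1]

lemma martingale_walk [IsProbabilityMeasure P] (hp : p = 1 / 2) :
    Martingale (fun n ω => (walk X Y n ω : ℝ))
      ⟨past X Y, past_mono, h.past_le⟩ P := by
  have hstep : ∀ m n, n < m → Measurable[past X Y m] (step X Y n) := fun m n hnm =>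
    Measurable.ite (measurable_pair_past hnm (_root_.measurableSet_lt measurable_fst measurable_snd))
      measurable_const measurable_const
  refine martingale_of_condExp_sub_eq_zero_nat (fun n => ?_) (fun n => ?_) fun n => ?_
  · refine Measurable.stronglyMeasurable ?_
    refine (measurable_from_top (f := fun k : ℤ => (k : ℝ))).comp ?_
    exact Finset.measurable_fun_sum _ fun k hk => hstep n k (Finset.mem_range.1 hk)
  · have : (fun ω => (walk X Y n ω : ℝ)) =
        fun ω => ∑ k ∈ Finset.range n, (step X Y k ω : ℝ) := by
      funext ω; simp [walk]
    rw [this]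
    exact integrable_finsetSum _ fun k _ => h.integrable_step k
  · have hd : ((fun ω => (walk X Y (n + 1) ω : ℝ)) - fun ω => (walk X Y n ω : ℝ))
        = fun ω => (step X Y n ω : ℝ) := by
      funext ω
      simp [walk_succ]
    have hm : Measurable[MeasurableSpace.comap (fun ω => (X n ω, Y n ω)) inferInstance]
        (step X Y n) :=
      Measurable.ite (measurableSet_lt_comap n) measurable_const measurable_const
    have hc := condExp_indep_eq (h.measurable_pair n).comap_le (h.past_le n)
      (((measurable_from_top (f := fun k : ℤ => (k : ℝ))).comp hm).stronglyMeasurable)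
      (h.indep_past n).symm
    rw [hd]
    refine hc.trans (ae_of_all _ fun _ => ?_)
    simp only [Function.comp_apply]
    rw [h.integral_step, hp]
    norm_num

/-- For a martingale with bounded increments, boundedness above is almost surely equivalent both to
convergence and to boundedness below. Steps of size one exclude convergence. -/
lemma ae_not_bdd_walk [IsProbabilityMeasure P] (hp : p = 1 / 2) :
    ∀ᵐ ω ∂P, ¬ BddBelow (Set.range fun n => walk X Y n ω) ∧
      ¬ BddAbove (Set.range fun n => walk X Y n ω) := by
  have hmart := h.martingale_walk hp
  have hbdd : ∀ᵐ ω ∂P, ∀ n, |(walk X Y (n + 1) ω : ℝ) - walk X Y n ω| ≤ (1 : NNReal) :=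
    ae_of_all _ fun ω n => by
      rcases step_eq_or X Y ω n with h1 | h1 <;> simp [walk_succ, h1]
  filter_upwards [hmart.submartingale.bddAbove_iff_exists_tendsto hbdd,
    hmart.bddAbove_range_iff_bddBelow_range hbdd] with ω h1 h2
  have hna : ¬ BddAbove (Set.range fun n => (walk X Y n ω : ℝ)) := by
    rw [h1]
    rintro ⟨c, hc⟩
    have h3 := ((hc.comp (tendsto_add_atTop_nat 1)).sub hc).abs
    rw [sub_self, abs_zero] at h3
    have h4 : Tendsto (fun _ : ℕ => (1 : ℝ)) atTop (𝓝 0) := h3.congr fun n => by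
      rcases step_eq_or X Y ω n with h1 | h1 <;> simp [walk_succ, h1]
    exact one_ne_zero (tendsto_nhds_unique tendsto_const_nhds h4)
  refine ⟨fun ⟨c, hc⟩ => hna (h2.2 ⟨c, ?_⟩), fun ⟨c, hc⟩ => hna ⟨c, ?_⟩⟩
  · rintro _ ⟨n, rfl⟩
    exact Int.cast_le.2 (hc ⟨n, rfl⟩)
  · rintro _ ⟨n, rfl⟩
    exact Int.cast_le.2 (hc ⟨n, rfl⟩)

/-- At the critical ratio the embedded queue is recurrent. -/
lemma isRecurrent [IsProbabilityMeasure P] (hp : p = 1 / 2) :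
    IsRecurrent P (embeddedQueue X Y) := by
  intro i
  filter_upwards [h.ae_not_bdd_walk hp] with ω hω
  exact frequently_embeddedQueue_eq X Y ω i i hω.1 hω.2

lemma measurable_excursion (n : ℕ) : Measurable (excursion X Y n) :=
  (measurable_excursion_past X Y n).mono (h.past_le _) le_rfl

lemma integrable_excursion [IsProbabilityMeasure P] (n : ℕ) :
    Integrable (fun ω => (excursion X Y n ω : ℝ)) P := by
  refine Integrable.of_bound ((measurable_from_top (f := fun k : ℤ => (k : ℝ))).comp
    (h.measurable_excursion n)).aestronglyMeasurable (n + 1) (ae_of_all _ fun ω => ?_)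
  have h0 := excursion_nonneg X Y n ω
  have h1 := excursion_le X Y n ω
  rw [Real.norm_of_nonneg (by exact_mod_cast h0)]
  exact_mod_cast h1

/-- A stopped fair walk keeps its mean: whether the excursion is still running is decided by the
past, and the next step is fair and independent of it. The initial mean is `p = 1/2`. -/
lemma integral_excursion [IsProbabilityMeasure P] (hp : p = 1 / 2) (n : ℕ) :
    ∫ ω, (excursion X Y n ω : ℝ) ∂P = 1 / 2 := by
  induction n with
  | zero =>
    have h1 : (fun ω => (excursion X Y 0 ω : ℝ)) =
        {ω | X 0 ω < Y 0 ω}.indicator fun _ => (1 : ℝ) := by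
      funext ω
      by_cases hω : X 0 ω < Y 0 ω <;> simp [excursion, hω]
    rw [h1, integral_indicator_const _ (h.measurableSet_lt 0), h.prob, hp]
    simp
  | succ n ih =>
    set E : Set Ω := {ω | 0 < excursion X Y n ω} with hE
    have hEm : MeasurableSet[past X Y (n + 1)] E :=
      measurable_excursion_past X Y n measurableSet_Ioi
    have hEm' : MeasurableSet E := h.past_le _ _ hEm
    have h1 : (fun ω => (excursion X Y (n + 1) ω : ℝ)) = fun ω => (excursion X Y n ω : ℝ) +
        ((E ∩ {ω | X (n + 1) ω < Y (n + 1) ω}).indicator (fun _ => (1 : ℝ)) ω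
          - (E \ {ω | X (n + 1) ω < Y (n + 1) ω}).indicator (fun _ => (1 : ℝ)) ω) := by
      funext ω
      by_cases h0 : 0 < excursion X Y n ω <;> by_cases hω : X (n + 1) ω < Y (n + 1) ω <;>
        simp [excursion, step, hE, h0, hω]
    have hm1 := hEm'.inter (h.measurableSet_lt (n + 1))
    have hm2 := hEm'.diff (h.measurableSet_lt (n + 1))
    have hi1 := (integrable_const (μ := P) (1 : ℝ)).indicator hm1
    have hi2 := (integrable_const (μ := P) (1 : ℝ)).indicator hm2
    have hi3 : Integrable (fun ω =>
        (E ∩ {ω | X (n + 1) ω < Y (n + 1) ω}).indicator (fun _ => (1 : ℝ)) ω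
          - (E \ {ω | X (n + 1) ω < Y (n + 1) ω}).indicator (fun _ => (1 : ℝ)) ω) P := hi1.sub hi2
    rw [h1, integral_add (h.integrable_excursion n) hi3, ih, integral_sub hi1 hi2,
      integral_indicator_const _ hm1, integral_indicator_const _ hm2, h.real_inter_lt hEm,
      h.real_sdiff_lt hEm, hp]
    norm_num

/-- At the critical ratio the embedded queue is null recurrent. -/
lemma isNullRecurrent [IsProbabilityMeasure P] (hp : p = 1 / 2) :
    IsNullRecurrent P (embeddedQueue X Y) := by
  refine ⟨h.isRecurrent hp, fun i => ?_⟩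
  by_contra hfin
  -- A finite mean return time would be an integrable majorant, and the excursion heights, which
  -- vanish eventually by recurrence, would have means tending to `0` instead of staying at `1/2`.
  have hlim := tendsto_lintegral_of_dominated_convergence (μ := P)
    (F := fun n ω => ENNReal.ofReal (excursion X Y n ω)) (f := fun _ => 0)
    (returnTime (embeddedQueue X Y) i)
    (fun n => ((measurable_from_top (f := fun k : ℤ => ENNReal.ofReal k)).comp
      (h.measurable_excursion n)))
    (fun n => ae_of_all _ fun ω => ofReal_excursion_le_returnTime X Y i n ω) hfin (by
      filter_upwards [h.isRecurrent hp i] with ω hω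
      obtain ⟨m, hm, hmi⟩ := frequently_atTop.1 hω 1
      refine tendsto_const_nhds.congr' ?_
      filter_upwards [eventually_ge_atTop m] with n hn
      simp [excursion_eq_zero_of_return X Y ω hm (by omega : m ≤ n + 1) hmi])
  have hconst : ∀ n, ∫⁻ ω, ENNReal.ofReal (excursion X Y n ω) ∂P = ENNReal.ofReal (1 / 2) :=
    fun n => by
      rw [← ofReal_integral_eq_lintegral_ofReal (h.integrable_excursion n)
        (ae_of_all _ fun ω => Int.cast_nonneg (excursion_nonneg X Y n ω)),
        h.integral_excursion hp]
  simp only [hconst, lintegral_zero] at hlim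
  have := tendsto_nhds_unique tendsto_const_nhds hlim
  rw [ENNReal.ofReal_eq_zero] at this
  norm_num at this

lemma not_isTransient_of_le [IsProbabilityMeasure P] (hp0 : 0 < p) (hp : p ≤ 1 / 2) :
    ¬ IsTransient P (embeddedQueue X Y) := by
  rcases hp.lt_or_eq with hp | hp
  · exact h.not_isTransient_of_lt hp0 hp
  · intro htr
    have h1 := measure_eq_zero_iff_ae_notMem.1 (htr 0)
    obtain ⟨ω, h2, h3⟩ := (h1.and (h.isRecurrent hp 0)).exists
    exact h2 h3

end IsIIDClocks

end

end RenewalQueue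

theorem mainTheorem3 (a b : ℝ) (ha : a ∈ Set.Ioo (0 : ℝ) 1) (hb : b ∈ Set.Ioo (0 : ℝ) 1) :
    ∃ ρ : ℝ, 0 < ρ ∧
      ∀ (lam mu : ℝ), 0 < lam → 0 < mu →
      ∀ (Ω : Type*) [MeasurableSpace Ω] (P : Measure Ω) [IsProbabilityMeasure P]
        (X Y : ℕ → Ω → ℝ), IsMittagLefflerClocks P a b lam mu X Y →
        (IsTransient P (embeddedQueue X Y) ↔ ρ < lam / mu) ∧
        (lam / mu < ρ →
          ∃ π : PMF ℕ,
            (∀ j, (π j).toReal = equilibriumWeight (P.real {ω | X 0 ω < Y 0 ω}) j) ∧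
            (∀ ν : PMF ℕ, IsInvariant P (embeddedQueue X Y) ν ↔ ν = π) ∧
            (∀ i j, Tendsto (fun n : ℕ => P.real {ω | embeddedQueue X Y i n ω = j})
              atTop (𝓝 (π j).toReal)) ∧
            (∀ i j, Tendsto (fun t : ℝ => P.real {ω | queueLength X Y i t ω = j})
              atTop (𝓝 (π j).toReal))) ∧
        (lam / mu = ρ → IsNullRecurrent P (embeddedQueue X Y)) := by
  obtain ⟨ρ, hρ, H⟩ := exists_criticalRatio ha hb
  refine ⟨ρ, hρ, fun lam mu hlam hmu Ω _ P _ X Y h => ?_⟩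
  obtain ⟨p, hp0, hp1, hp, hlt, heq⟩ := H lam mu hlam hmu Ω P X Y h
  have hc := h.isIIDClocks ha.1 hb.1 hlam hmu hp
  refine ⟨⟨fun htr => ?_, fun hgt => hc.isTransient ?_⟩, fun hl => ?_,
    fun he => hc.isNullRecurrent (heq.2 he)⟩
  · by_contra hle
    refine hc.not_isTransient_of_le hp0 ?_ htr
    rcases (not_lt.1 hle).lt_or_eq with hl | he
    · exact (hlt.2 hl).le
    · exact (heq.2 he).le
  · refine lt_of_le_of_ne (not_lt.1 fun hl => hgt.not_gt (hlt.1 hl)) fun he => ?_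
    exact hgt.ne' (heq.1 he.symm)
  · rw [hp 0]
    exact hc.exists_equilibrium hp0 (hlt.2 hl)
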